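/- Let $(W,S)$ be a Coxeter system with $S$ finite and Coxeter matrix $(m_{st})$. For $U\subseteq S$ let $W_U$ be the subgroup generated by $U$; call $U$ spherical if $W_U$ is finite. Suppose that $(W,S)$ is even (for all $s\neq t$ in $S$, $m_{st}$ is even or infinite) and that its nerve $L$ (the simplicial complex with vertex set $S$ whose simplices are the nonempty spherical subsets of $S$) is a flag triangulation of the $3$-sphere $\mathbb{S}^3$. Let $\Sigma$ be the Davis complex of $(W,S)$ with its cellulation by Coxeter cells: the cells of type $T'$ ($T'\subseteq S$ spherical) are the cosets $wW_{T'}$, such a cell has dimension $\operatorname{Card}(T')$, and faces are given by inclusion of cosets. For $V\subseteq S$ and a spherical subset $T\subseteq V$, let $\Omega(V,T)$ be the subcomplex that is the union of the closed cells of type $T'$ with $T'$ spherical and $T\subseteq T'\subseteq V$, and let $\partial\Omega(V,T)$ be the subcomplex of those cells of $\Omega(V,T)$ whose type does not contain $T$. For a pair of subcomplexes, let $\mathcal{H}_{k}$ denote the $k$-th reduced relative $\ell^2$-homology: the kernel of $\partial_k$ modulo the closure of the image of $\partial_{k+1}$, on square-summable (real or complex) relative cellular chains. Then for every $V\subseteq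 S$ and every spherical subset $T\subseteq V$ with $\operatorname{Card}(T)=2$, \[\mathcal{H}_{4}(\Omega(V,T),\partial\Omega(V,T))=0.\] -/

import Mathlib

noncomputable section

/-! ### Flag complexes and triangulations of spheres -/

namespace AbstractSimplicialComplex

variable {S : Type*}

/-- A simplicial complex is flag if every nonempty finite set of pairwise adjacent vertices
spans a simplex. -/
def IsFlag [DecidableEq S] (L : AbstractSimplicialComplex S) : Prop :=
  ∀ T : Finset S, T.Nonempty → (∀ s ∈ T, ∀ t ∈ T, s ≠ t → {s, t} ∈ L) → T ∈ L

/-- The geometric realization of a simplicial complex with finitely many vertices: the union, over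
the simplices `T`, of the faces of the standard simplex spanned by `T`. -/
def realization [Fintype S] (L : AbstractSimplicialComplex S) : Set (S → ℝ) :=
  {x | x ∈ stdSimplex ℝ S ∧ ∃ T ∈ L, ∀ s, s ∉ T → x s = 0}

/-- `L` is a triangulation of the `n`-sphere. -/
def IsTriangulationOfSphere [Fintype S] (L : AbstractSimplicialComplex S) (n : ℕ) : Prop :=
  Nonempty (L.realization ≃ₜ Metric.sphere (0 : EuclideanSpace ℝ (Fin (n + 1))) 1)

end AbstractSimplicialComplex

namespace CoxeterSystem

variable {S W : Type*} [Group W] {M : CoxeterMatrix S} (cs : CoxeterSystem M W)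

/-- The Coxeter system is even: each `m_{st}` with `s ≠ t` is even or infinite
(an infinite entry of `M` is recorded as `0`). -/
def IsEven (_cs : CoxeterSystem M W) : Prop :=
  ∀ s t : S, s ≠ t → M s t = 0 ∨ Even (M s t)

/-- The special subgroup `W_T` generated by `T`. -/
def special (T : Finset S) : Subgroup W :=
  Subgroup.closure (cs.simple '' (T : Set S))

/-- `T` is spherical if `W_T` is finite. -/
def IsSpherical (T : Finset S) : Prop :=
  Finite (cs.special T)

theorem special_mono {T T' : Finset S} (h : T ⊆ T') : cs.special T ≤ cs.special T' :=
  Subgroup.closure_mono (Set.image_mono (Finset.coe_subset.mpr h))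

theorem IsSpherical.mono {cs : CoxeterSystem M W} {T T' : Finset S} (hT' : cs.IsSpherical T')
    (h : T ⊆ T') : cs.IsSpherical T :=
  haveI : Finite (cs.special T') := hT'
  Finite.of_injective _ (Subgroup.inclusion_injective (cs.special_mono h))

theorem isSpherical_singleton (s : S) : cs.IsSpherical {s} := by
  have h : cs.special {s} = Subgroup.zpowers (cs.simple s) := by
    simp [special, Subgroup.zpowers_eq_closure]
  have h2 : IsOfFinOrder (cs.simple s) :=
    isOfFinOrder_iff_pow_eq_one.mpr ⟨2, by norm_num, by simp [pow_two]⟩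
  unfold IsSpherical
  rw [h]
  exact h2.finite_zpowers

/-- The nerve of the Coxeter system: its simplices are the nonempty spherical subsets. -/
def nerve : AbstractSimplicialComplex S where
  faces := {T | T.Nonempty ∧ cs.IsSpherical T}
  isRelLowerSet_faces := fun _ hT => ⟨hT.1, fun _ hsub hne => ⟨hne, hT.2.mono hsub⟩⟩
  singleton_mem := fun s => ⟨Finset.singleton_nonempty s, cs.isSpherical_singleton s⟩

/-! ### The cells of the Davis complex -/

/-- A Coxeter cell of the Davis complex: a spherical coset `w W_T`, together with its type `T`. -/
structure Cell where
  /-- the type of the cell -/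
  type : Finset S
  spherical : cs.IsSpherical type
  /-- the spherical coset -/
  coset : W ⧸ cs.special type

namespace Cell

variable {cs}

/-- The vertex set of a cell: the elements of the coset. -/
def vertices (c : cs.Cell) : Set W := {w | (w : W ⧸ cs.special c.type) = c.coset}

/-- The dimension of a cell of type `T` is the cardinality of `T`. -/
def dim (c : cs.Cell) : ℕ := c.type.card

/-- `c ≤ d` means that the cell `c` is a face of the cell `d`. -/
instance : Preorder cs.Cell where
  le c d := c.type ⊆ d.type ∧ c.vertices ⊆ d.vertices
  le_refl _ := ⟨subset_rfl, subset_rfl⟩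
  le_trans _ _ _ h h' := ⟨h.1.trans h'.1, h.2.trans h'.2⟩

/-- A chosen vertex of each cell. -/
def base (c : cs.Cell) : W := Quotient.out c.coset

/-- The incidence number `[c : d]` of a cell `c` and a cell `d`, which is nonzero only if `d` is a
face of codimension one of `c`.

Orientations: a cell of type `T = {s₁ < ⋯ < sₖ}` is a convex polytope whose edges at a vertex `w`
lead to the vertices `w s₁, …, w sₖ`. We orient it by this ordered frame at the vertex `base c`.
Since `u ∈ W_T` acts on the canonical representation with determinant `(-1)^ℓ(u)`, the frame at the
vertex `base c * u` defines `(-1)^ℓ(u)` times this orientation. If the face `d` has type `T - r`,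
then at a vertex of `d` the edge labelled by `r` points from `d` into `c`, so that the convention
"outward normal first" gives the sign below; the sum in the exponent has the single index `r`. -/
def incidence [LinearOrder S] (c d : cs.Cell) : ℤ :=
  open Classical in
  if d ≤ c ∧ d.dim + 1 = c.dim then
    -((-1) ^ (∑ r ∈ c.type \ d.type, (c.type.filter (· < r)).card) *
      (-1) ^ cs.length (c.base⁻¹ * d.base))
  else 0

theorem mem_vertices {c : cs.Cell} {w : W} :
    w ∈ c.vertices ↔ (w : W ⧸ cs.special c.type) = c.coset := Iff.rfl

theorem base_mem (c : cs.Cell) : c.base ∈ c.vertices :=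
  QuotientGroup.out_eq' c.coset

theorem ext_of_mem {c d : cs.Cell} (h : c.type = d.type) {w : W} (hc : w ∈ c.vertices)
    (hd : w ∈ d.vertices) : c = d := by
  obtain ⟨T, hT, x⟩ := c
  obtain ⟨T', hT', y⟩ := d
  obtain rfl : T = T' := h
  rw [mem_vertices] at hc hd
  simp only at hc hd
  rw [← hc, ← hd]

theorem inv_mul_mem {c : cs.Cell} {v w : W} (hv : v ∈ c.vertices) (hw : w ∈ c.vertices) :
    v⁻¹ * w ∈ cs.special c.type :=
  QuotientGroup.eq.mp (hv.trans hw.symm)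

theorem mul_mem {c : cs.Cell} {v u : W} (hv : v ∈ c.vertices) (hu : u ∈ cs.special c.type) :
    v * u ∈ c.vertices := by
  rw [mem_vertices] at hv ⊢
  rw [← hv]
  exact (QuotientGroup.eq.mpr (by simpa using hu)).symm

theorem le_iff_of_mem {c d : cs.Cell} {w : W} (hw : w ∈ c.vertices) :
    c ≤ d ↔ c.type ⊆ d.type ∧ w ∈ d.vertices := by
  refine ⟨fun h => ⟨h.1, h.2 hw⟩, fun h => ⟨h.1, fun v hv => ?_⟩⟩
  have := mul_mem h.2 (cs.special_mono h.1 (inv_mul_mem hw hv))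
  simpa using this

theorem incidence_ne_zero [LinearOrder S] {c d : cs.Cell} (h : incidence c d ≠ 0) :
    d ≤ c ∧ d.dim + 1 = c.dim := by
  by_contra hn
  exact h (by rw [incidence, if_neg hn])

theorem abs_incidence_le [LinearOrder S] (c d : cs.Cell) : |incidence c d| ≤ 1 := by
  unfold incidence
  split_ifs <;> simp [abs_mul]

theorem neg_one_pow_length_mul (v w : W) :
    (-1 : ℤ) ^ cs.length (v * w) = (-1) ^ cs.length v * (-1) ^ cs.length w := by
  rw [← pow_add, neg_one_pow_eq_pow_mod_two, cs.length_mul_mod_two, ← neg_one_pow_eq_pow_mod_two]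

theorem exists_type_eq_insert [DecidableEq S] {c d : cs.Cell} (h : d ≤ c)
    (hdim : d.dim + 1 = c.dim) : ∃ r, r ∉ d.type ∧ c.type = insert r d.type := by
  obtain ⟨r, hr, he⟩ :=
    (Finset.covBy_iff_exists_insert (s := d.type) (t := c.type)).mp
      ((Finset.covBy_iff_card_sdiff_eq_one).mpr ⟨h.1, by
        have := Finset.card_sdiff_add_card_eq_card h.1
        unfold dim at hdim
        omega⟩)
  exact ⟨r, hr, he.symm⟩

theorem incidence_eq_of_insert [LinearOrder S] {c d : cs.Cell} {r : S} (h : d ≤ c)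
    (hr : r ∉ d.type) (hc : c.type = insert r d.type) :
    incidence c d = -((-1) ^ (d.type.filter (· < r)).card *
      (-1) ^ cs.length (c.base⁻¹ * d.base)) := by
  have hdim : d.dim + 1 = c.dim := by
    unfold dim
    rw [hc, Finset.card_insert_of_notMem hr]
  have h1 : c.type \ d.type = {r} := by
    rw [hc, Finset.insert_sdiff_of_notMem _ hr]
    simp
  rw [incidence, if_pos ⟨h, hdim⟩, h1, Finset.sum_singleton, hc, Finset.filter_insert]
  simp

/-- The second cell between `d` and `c`, if `e` is the first. -/
def other [DecidableEq S] (c e d : cs.Cell) (h : d ≤ c) : cs.Cell where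
  type := (c.type \ e.type) ∪ d.type
  spherical := c.spherical.mono (Finset.union_subset Finset.sdiff_subset h.1)
  coset := (d.base : W ⧸ cs.special ((c.type \ e.type) ∪ d.type))

theorem other_spec [LinearOrder S] {c e d : cs.Cell} (hce : incidence c e ≠ 0)
    (hed : incidence e d ≠ 0) (h : d ≤ c) :
    incidence c (other c e d h) * incidence (other c e d h) d =
      -(incidence c e * incidence e d) ∧ other c e d h ≠ e ∧
    other c (other c e d h) d h = e ∧ d ≤ other c e d h ∧ other c e d h ≤ c ∧
    (other c e d h).dim = e.dim := by
  obtain ⟨h1, h1'⟩ := incidence_ne_zero hce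
  obtain ⟨h2, h2'⟩ := incidence_ne_zero hed
  obtain ⟨r, hr, hc⟩ := exists_type_eq_insert h1 h1'
  obtain ⟨q, hq, he⟩ := exists_type_eq_insert h2 h2'
  have hrq : r ≠ q := by
    rintro rfl
    exact hr (he ▸ Finset.mem_insert_self _ _)
  have hrd : r ∉ d.type := fun hh => hr (he ▸ Finset.mem_insert_of_mem hh)
  set o := other c e d h with ho
  have hot : o.type = insert r d.type := by
    change (c.type \ e.type) ∪ d.type = _
    rw [hc, Finset.insert_sdiff_of_notMem _ hr]
    simp
  have hob : d.base ∈ o.vertices := rfl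
  have hdo : d ≤ o := (le_iff_of_mem d.base_mem).mpr
    ⟨hot ▸ Finset.subset_insert _ _, hob⟩
  have hct : c.type = insert q o.type := by
    rw [hc, he, hot, Finset.insert_comm]
  have hoc : o ≤ c := (le_iff_of_mem hob).mpr
    ⟨hct ▸ Finset.subset_insert _ _, h.2 d.base_mem⟩
  have hqo : q ∉ o.type := by
    rw [hot]
    simp [hq, hrq.symm]
  refine ⟨?_, ?_, ?_, hdo, hoc, ?_⟩
  · rw [incidence_eq_of_insert hoc hqo hct, incidence_eq_of_insert hdo hrd hot,
      incidence_eq_of_insert h1 hr hc, incidence_eq_of_insert h2 hq he]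
    have e1 : (-1 : ℤ) ^ cs.length (c.base⁻¹ * d.base) =
        (-1) ^ cs.length (c.base⁻¹ * o.base) * (-1) ^ cs.length (o.base⁻¹ * d.base) := by
      rw [← neg_one_pow_length_mul]
      group
    have e2 : (-1 : ℤ) ^ cs.length (c.base⁻¹ * d.base) =
        (-1) ^ cs.length (c.base⁻¹ * e.base) * (-1) ^ cs.length (e.base⁻¹ * d.base) := by
      rw [← neg_one_pow_length_mul]
      group
    have e3 : (-1 : ℤ) ^ (o.type.filter (· < q)).card * (-1) ^ (d.type.filter (· < r)).card =
        -((-1) ^ (e.type.filter (· < r)).card * (-1) ^ (d.type.filter (· < q)).card) := by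
      rw [hot, he, Finset.filter_insert, Finset.filter_insert]
      rcases lt_or_gt_of_ne hrq with hlt | hlt
      · rw [if_pos hlt, if_neg hlt.not_gt, Finset.card_insert_of_notMem (by simp [hrd])]
        ring
      · rw [if_neg hlt.not_gt, if_pos hlt, Finset.card_insert_of_notMem (by simp [hq])]
        ring
    linear_combination (-1 : ℤ) ^ cs.length (c.base⁻¹ * o.base) *
        (-1) ^ cs.length (o.base⁻¹ * d.base) * e3 +
      (-1 : ℤ) ^ (e.type.filter (· < r)).card * (-1) ^ (d.type.filter (· < q)).card * (e1 - e2)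
  · intro hh
    exact hr (hh ▸ hot ▸ Finset.mem_insert_self _ _)
  · refine ext_of_mem (w := d.base) ?_ rfl (h2.2 d.base_mem)
    change (c.type \ o.type) ∪ d.type = _
    rw [hct, Finset.insert_sdiff_of_notMem _ hqo, he]
    simp
  · unfold dim
    rw [hot, he, Finset.card_insert_of_notMem hrd, Finset.card_insert_of_notMem hq]

theorem card_cofaces_le [Fintype S] (d : cs.Cell) (s : Finset cs.Cell) (hs : ∀ c ∈ s, d ≤ c) :
    s.card ≤ Fintype.card (Finset S) := by
  refine Finset.card_le_card_of_injOn Cell.type (fun _ _ => Finset.mem_univ _) ?_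
  intro c hc c' hc' h
  exact ext_of_mem h ((hs c hc).2 d.base_mem) ((hs c' hc').2 d.base_mem)

variable (cs) in
theorem exists_card_faces_le [Fintype S] :
    ∃ N : ℕ, ∀ (c : cs.Cell) (s : Finset cs.Cell), (∀ d ∈ s, d ≤ c) → s.card ≤ N := by
  classical
  let E : Set W := ⋃ T ∈ {T : Finset S | cs.IsSpherical T}, (cs.special T : Set W)
  have hE : E.Finite := by
    refine Set.Finite.biUnion (Set.toFinite _) fun T hT => ?_
    have : Finite (cs.special T) := hT
    exact Set.toFinite _
  refine ⟨((Finset.univ : Finset (Finset S)) ×ˢ hE.toFinset).card, fun c s hs => ?_⟩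
  refine Finset.card_le_card_of_injOn (fun d => (d.type, c.base⁻¹ * d.base)) ?_ ?_
  · intro d hd
    simp only [Finset.coe_product, Finset.coe_univ, Set.Finite.coe_toFinset, Set.mem_prod,
      Set.mem_univ, true_and]
    exact Set.mem_biUnion (x := c.type) c.spherical
      (inv_mul_mem c.base_mem ((hs d hd).2 d.base_mem))
  · intro d hd d' hd' h
    simp only [Prod.mk.injEq, mul_right_inj] at h
    exact ext_of_mem h.1 d.base_mem (h.2 ▸ d'.base_mem)

end Cell

/-! ### Reduced ℓ²-homology of a pair of subcomplexes -/

/-- The `k`-cells of the subcomplex `X` that do not lie in the subcomplex `A`. (A subcomplex is a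
set of cells that contains all faces of its members.) -/
abbrev RelCell (X A : LowerSet cs.Cell) (k : ℕ) : Type _ :=
  {c : cs.Cell // c ∈ X ∧ c ∉ A ∧ c.dim = k}

/-- The relative ℓ²-chains `C_k(X, A) = C_k(X) / C_k(A)`: the Hilbert space of square-summable
functions on the `k`-cells of `X` that do not lie in `A`. -/
abbrev L2Chain (𝕜 : Type*) [RCLike 𝕜] (X A : LowerSet cs.Cell) (k : ℕ) : Type _ :=
  lp (fun _ : cs.RelCell X A k => 𝕜) 2

section Boundary

variable [Fintype S] [LinearOrder S]
variable {cs} (𝕜 : Type*) [RCLike 𝕜] (X A : LowerSet cs.Cell) (k j : ℕ)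

variable {X A k} in
theorem finite_cofaces (d : cs.Cell) :
    {c : cs.RelCell X A k | c.1.incidence d ≠ 0}.Finite := by
  classical
  by_contra hinf
  obtain ⟨s, hs, hcard⟩ := (Set.not_finite.mp hinf : Set.Infinite _).exists_subset_card_eq
    (Fintype.card (Finset S) + 1)
  have := Cell.card_cofaces_le d (s.map ⟨Subtype.val, Subtype.val_injective⟩) (by
    intro c hc
    obtain ⟨c', hc', rfl⟩ := Finset.mem_map.mp hc
    exact (Cell.incidence_ne_zero (hs hc')).1)
  rw [Finset.card_map, hcard] at this
  omega

/-- The `k`-cells of `(X, A)` having `d` as a face of codimension one. -/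
def cofaces (d : cs.Cell) : Finset (cs.RelCell X A k) :=
  (finite_cofaces (X := X) (A := A) d).toFinset

variable {X A k} in
theorem mem_cofaces {d : cs.Cell} {c : cs.RelCell X A k} :
    c ∈ cofaces X A k d ↔ c.1.incidence d ≠ 0 := by
  simp [cofaces]

/-- The coefficient of the cell `d` in the boundary of the chain `f = ∑ f(c) c`. -/
def boundaryFun (f : cs.RelCell X A k → 𝕜) (d : cs.RelCell X A j) : 𝕜 :=
  ∑ c ∈ cofaces X A k d.1, (c.1.incidence d.1 : 𝕜) * f c

theorem exists_boundary_bound :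
    ∃ C : ℝ, 0 ≤ C ∧ ∀ (f : cs.L2Chain 𝕜 X A k) (D : Finset (cs.RelCell X A j)),
      ∑ d ∈ D, ‖boundaryFun 𝕜 X A k j f d‖ ^ 2 ≤ C * ‖f‖ ^ 2 := by
  classical
  obtain ⟨N, hN⟩ := Cell.exists_card_faces_le cs
  set n : ℕ := Fintype.card (Finset S)
  have hcof : ∀ d : cs.Cell, (cofaces X A k d).card ≤ n := by
    intro d
    have := Cell.card_cofaces_le d ((cofaces X A k d).map ⟨Subtype.val, Subtype.val_injective⟩) (by
      intro c hc
      obtain ⟨c', hc', rfl⟩ := Finset.mem_map.mp hc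
      exact (Cell.incidence_ne_zero (mem_cofaces.mp hc')).1)
    rwa [Finset.card_map] at this
  refine ⟨n * N, by positivity, fun f D => ?_⟩
  have h1 : ∀ d ∈ D, ‖boundaryFun 𝕜 X A k j f d‖ ^ 2 ≤
      n * ∑ c ∈ cofaces X A k d.1, ‖f c‖ ^ 2 := by
    intro d _
    have h2 : ‖boundaryFun 𝕜 X A k j f d‖ ≤ ∑ c ∈ cofaces X A k d.1, ‖f c‖ := by
      refine (norm_sum_le _ _).trans (Finset.sum_le_sum fun c _ => ?_)
      rw [norm_mul, ← RCLike.ofReal_intCast, RCLike.norm_ofReal]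
      have : |((c.1.incidence d.1 : ℤ) : ℝ)| ≤ 1 := by
        exact_mod_cast Cell.abs_incidence_le c.1 d.1
      nlinarith [norm_nonneg (f c)]
    calc ‖boundaryFun 𝕜 X A k j f d‖ ^ 2 ≤ (∑ c ∈ cofaces X A k d.1, ‖f c‖) ^ 2 := by gcongr
      _ ≤ (cofaces X A k d.1).card * ∑ c ∈ cofaces X A k d.1, ‖f c‖ ^ 2 :=
        sq_sum_le_card_mul_sum_sq
      _ ≤ n * ∑ c ∈ cofaces X A k d.1, ‖f c‖ ^ 2 := by
        gcongr
        exact hcof _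
  have h3 : ∀ s : Finset (cs.RelCell X A k), ∑ c ∈ s, ‖f c‖ ^ 2 ≤ ‖f‖ ^ 2 := by
    intro s
    simpa using lp.sum_rpow_le_norm_rpow (p := 2) (by norm_num) f s
  set B := D.biUnion fun d => cofaces X A k d.1
  have h4 : ∑ d ∈ D, ∑ c ∈ cofaces X A k d.1, ‖f c‖ ^ 2 ≤ N * ∑ c ∈ B, ‖f c‖ ^ 2 := by
    have h5 : ∀ d ∈ D, ∑ c ∈ cofaces X A k d.1, ‖f c‖ ^ 2 =
        ∑ c ∈ B, if c ∈ cofaces X A k d.1 then ‖f c‖ ^ 2 else 0 := by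
      intro d hd
      rw [← Finset.sum_filter]
      congr 1
      ext c
      simp only [Finset.mem_filter, B, Finset.mem_biUnion]
      exact ⟨fun h => ⟨⟨d, hd, h⟩, h⟩, fun h => h.2⟩
    rw [Finset.sum_congr rfl h5, Finset.sum_comm, Finset.mul_sum]
    refine Finset.sum_le_sum fun c _ => ?_
    rw [← Finset.sum_filter, Finset.sum_const, nsmul_eq_mul]
    gcongr
    have := hN c.1 ((D.filter fun d => c ∈ cofaces X A k d.1).map
      ⟨Subtype.val, Subtype.val_injective⟩) (by
      intro d hd
      obtain ⟨d', hd', rfl⟩ := Finset.mem_map.mp hd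
      exact (Cell.incidence_ne_zero (mem_cofaces.mp (Finset.mem_filter.mp hd').2)).1)
    rwa [Finset.card_map] at this
  calc ∑ d ∈ D, ‖boundaryFun 𝕜 X A k j f d‖ ^ 2
      ≤ ∑ d ∈ D, n * ∑ c ∈ cofaces X A k d.1, ‖f c‖ ^ 2 := Finset.sum_le_sum h1
    _ = n * ∑ d ∈ D, ∑ c ∈ cofaces X A k d.1, ‖f c‖ ^ 2 := by rw [Finset.mul_sum]
    _ ≤ n * (N * ∑ c ∈ B, ‖f c‖ ^ 2) := by gcongr
    _ ≤ n * (N * ‖f‖ ^ 2) := by gcongr; exact h3 B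
    _ = n * N * ‖f‖ ^ 2 := by ring

theorem memℓp_boundaryFun (f : cs.L2Chain 𝕜 X A k) :
    Memℓp (E := fun _ : cs.RelCell X A j => 𝕜) (boundaryFun 𝕜 X A k j f) 2 := by
  obtain ⟨C, -, hC⟩ := exists_boundary_bound 𝕜 X A k j
  refine memℓp_gen' (C := C * ‖f‖ ^ 2) fun D => ?_
  simpa using hC f D

/-- The boundary operator `∂ : C_k(X, A) → C_j(X, A)` of relative ℓ²-chains; it is zero unless
`k = j + 1`. -/
def boundary : cs.L2Chain 𝕜 X A k →L[𝕜] cs.L2Chain 𝕜 X A j :=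
  LinearMap.mkContinuousOfExistsBound
    { toFun := fun f => ⟨boundaryFun 𝕜 X A k j f, memℓp_boundaryFun 𝕜 X A k j f⟩
      map_add' := fun f g => by
        ext d
        change boundaryFun 𝕜 X A k j (f + g) d =
          boundaryFun 𝕜 X A k j f d + boundaryFun 𝕜 X A k j g d
        simp [boundaryFun, mul_add, Finset.sum_add_distrib]
      map_smul' := fun a f => by
        ext d
        simp [boundaryFun, Finset.mul_sum, mul_left_comm] }
    (by
      obtain ⟨C, hC0, hC⟩ := exists_boundary_bound 𝕜 X A k j
      refine ⟨√C, fun f => ?_⟩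
      refine lp.norm_le_of_forall_sum_le (p := 2) (by norm_num) (by positivity) fun D => ?_
      have h := hC f D
      have h' : (√C * ‖f‖) ^ 2 = C * ‖f‖ ^ 2 := by rw [mul_pow, Real.sq_sqrt hC0]
      simpa [h'] using h)

theorem boundary_apply (f : cs.L2Chain 𝕜 X A k) (d : cs.RelCell X A j) :
    boundary 𝕜 X A k j f d = ∑ c ∈ cofaces X A k d.1, (c.1.incidence d.1 : 𝕜) * f c := rfl

/-- `∂ ∘ ∂ = 0`. -/
theorem boundary_boundary (i : ℕ) (f : cs.L2Chain 𝕜 X A k) :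
    boundary 𝕜 X A j i (boundary 𝕜 X A k j f) = 0 := by
  classical
  ext d
  rw [boundary_apply]
  simp only [boundary_apply, Finset.mul_sum]
  rw [Finset.sum_sigma']
  have key : ∀ p ∈ (cofaces X A j d.1).sigma fun e => cofaces X A k e.1,
      p.2.1.incidence p.1.1 ≠ 0 ∧ p.1.1.incidence d.1 ≠ 0 := by
    intro p hp
    obtain ⟨h1, h2⟩ := Finset.mem_sigma.mp hp
    exact ⟨mem_cofaces.mp h2, mem_cofaces.mp h1⟩
  have hle : ∀ p ∈ (cofaces X A j d.1).sigma fun e => cofaces X A k e.1, d.1 ≤ p.2.1 :=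
    fun p hp => (Cell.incidence_ne_zero (key p hp).2).1.trans
      (Cell.incidence_ne_zero (key p hp).1).1
  have spec := fun p hp => Cell.other_spec (key p hp).1 (key p hp).2 (hle p hp)
  have hinv : ∀ p (hp : p ∈ (cofaces X A j d.1).sigma fun e => cofaces X A k e.1),
      Cell.other p.2.1 p.1.1 d.1 (hle p hp) ∈ X ∧
      Cell.other p.2.1 p.1.1 d.1 (hle p hp) ∉ A ∧
      (Cell.other p.2.1 p.1.1 d.1 (hle p hp)).dim = j := fun p hp =>
    ⟨X.lower (spec p hp).2.2.2.2.1 p.2.2.1,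
      fun h => d.2.2.1 (A.lower (spec p hp).2.2.2.1 h),
      (spec p hp).2.2.2.2.2.trans p.1.2.2.2⟩
  refine Finset.sum_involution
    (fun p hp => ⟨⟨Cell.other p.2.1 p.1.1 d.1 (hle p hp), hinv p hp⟩, p.2⟩) ?_ ?_ ?_ ?_
  · intro p hp
    have h := (spec p hp).1
    have h' : ((p.2.1.incidence (Cell.other p.2.1 p.1.1 d.1 (hle p hp)) : ℤ) : 𝕜) *
        ((Cell.other p.2.1 p.1.1 d.1 (hle p hp)).incidence d.1 : ℤ) =
        -((p.2.1.incidence p.1.1 : ℤ) * (p.1.1.incidence d.1 : ℤ)) := by exact_mod_cast h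
    linear_combination f p.2 * h'
  · intro p hp _ h
    exact (spec p hp).2.1 (congrArg (fun q => q.1.1) h)
  · intro p hp
    have h := (spec p hp).1
    have hne : p.2.1.incidence p.1.1 * p.1.1.incidence d.1 ≠ 0 :=
      mul_ne_zero (key p hp).1 (key p hp).2
    rw [← neg_ne_zero, ← h] at hne
    exact Finset.mem_sigma.mpr
      ⟨mem_cofaces.mpr (right_ne_zero_of_mul hne), mem_cofaces.mpr (left_ne_zero_of_mul hne)⟩
  · intro p hp
    refine Sigma.ext (Subtype.ext (spec p hp).2.2.1) HEq.rfl

/-- The relative ℓ²-cycles. In degree zero this is everything, because `boundary 𝕜 X A 0 0 = 0`. -/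
def cycles : Submodule 𝕜 (cs.L2Chain 𝕜 X A k) :=
  LinearMap.ker (boundary 𝕜 X A k (k - 1)).toLinearMap

/-- The closure of the space of relative ℓ²-boundaries. -/
def closedBoundaries : Submodule 𝕜 (cs.L2Chain 𝕜 X A k) :=
  (LinearMap.range (boundary 𝕜 X A (k + 1) k).toLinearMap).topologicalClosure

theorem closedBoundaries_le_cycles : closedBoundaries 𝕜 X A k ≤ cycles 𝕜 X A k := by
  refine Submodule.topologicalClosure_minimal _ ?_ (boundary 𝕜 X A k (k - 1)).isClosed_ker
  rintro _ ⟨f, rfl⟩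
  exact boundary_boundary 𝕜 X A (k + 1) k (k - 1) f

/-- The reduced ℓ²-homology `H_k(X, A)`: the cycles modulo the closure of the boundaries. -/
abbrev ReducedL2Homology : Type _ :=
  cycles 𝕜 X A k ⧸ (closedBoundaries 𝕜 X A k).submoduleOf (cycles 𝕜 X A k)

end Boundary

/-! ### Ruins -/

section Ruins

/-- `Ω(U, T)`: the union of the closed cells of type `T'`, with `T ⊆ T' ⊆ U` spherical. -/
def ruin (U T : Finset S) : LowerSet cs.Cell :=
  lowerClosure {c | T ⊆ c.type ∧ c.type ⊆ U}

/-- `∂Ω(U, T)`: the cells of `Ω(U, T)` whose type `T''` does not satisfy `T ⊆ T'' ⊆ U`. -/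
def ruinBoundary (U T : Finset S) : LowerSet cs.Cell where
  carrier := {c | c ∈ cs.ruin U T ∧ ¬ (T ⊆ c.type ∧ c.type ⊆ U)}
  lower' := by
    rintro c d hdc ⟨hc, hn⟩
    refine ⟨(cs.ruin U T).lower hdc hc, fun h => hn ⟨h.1.trans hdc.1, ?_⟩⟩
    obtain ⟨e, he, hce⟩ := hc
    exact hce.1.trans he.2

end Ruins

end CoxeterSystem

end

/-! ### Degree of a Lipschitz perturbation of the identity -/

section Brouwer

open MeasureTheory Metric Set Module
open scoped Topology

variable {E : Type*} [NormedAddCommGroup E]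

/-! There are no nonzero relative ℓ²-cycles in degree 4. Let `f` be such a cycle and let a 4-cell
have type `U ∪ {a}`, where `U ⊇ T` has three elements. Look at its face of type `U`. If no other
cell of the pair contains this face, then `∂f = 0` there kills the coefficient of the cell.
Otherwise some tetrahedron `U ∪ {e}` of the nerve lies on the other side of the triangle `U`. In a
3-sphere these two are the only maximal simplices containing `U`. So `{a, e}` is not spherical:
flagness would make `U ∪ {a, e}` a simplex. Now `∂f = 0` says that the coefficients of the two cells
at the face have the same absolute value. Crossing faces alternately propagates this value along a
coset of the infinite group generated by `a` and `e`, through infinitely many cells, and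
square-summability forces it to be 0 (`apply_eq_zero_of_not_isSpherical_pair`).

The topological input, `IsTriangulationOfSphere.subset_or_subset`, is invariance of domain: two
tetrahedra glued along a triangle contain a 3-ball around its barycentre, which must be a
neighbourhood in the sphere, leaving no room for another simplex. Invariance of domain is deduced
from the no-retraction theorem, itself proved by integrating a Jacobian determinant. -/

theorem bijective_id_add_of_lipschitzWith [CompleteSpace E] {g : E → E} {K : NNReal} (hK : K < 1)
    (hg : LipschitzWith K g) : Function.Bijective fun x => x + g x := by
  constructor
  · intro x y hxy
    have h : x - y = g y - g x := by
      have : x + g x = y + g y := hxy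
      rw [sub_eq_sub_iff_add_eq_add, this, add_comm]
    have h2 := hg.dist_le_mul y x
    rw [dist_eq_norm, dist_eq_norm, ← h, norm_sub_rev y x] at h2
    have hK' : (K : ℝ) < 1 := hK
    have : ‖x - y‖ = 0 := by nlinarith [norm_nonneg (x - y)]
    exact sub_eq_zero.mp (norm_eq_zero.mp this)
  · intro y
    have hc : ContractingWith K fun x => y - g x := by
      refine ⟨hK, LipschitzWith.of_dist_le_mul fun a b => ?_⟩
      rw [dist_sub_left]
      exact hg.dist_le_mul a b
    refine ⟨hc.fixedPoint, ?_⟩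
    have := hc.fixedPoint_isFixedPt
    have h : y - g hc.fixedPoint = hc.fixedPoint := this
    change hc.fixedPoint + g hc.fixedPoint = y
    nth_rw 1 [← h]
    abel

/-- Along `1 + t A`, `0 ≤ t ≤ 1`, the determinant starts at 1 and cannot vanish: a kernel vector
satisfies `x = -t A x`, which is impossible when `‖A‖ < 1`. -/
theorem det_one_add_pos_of_norm_lt_one [NormedSpace ℝ E] [FiniteDimensional ℝ E] {A : E →L[ℝ] E}
    (hA : ‖A‖ < 1) : 0 < (1 + A).det := by
  by_contra! hneg
  have hcont : ContinuousOn (fun t : ℝ => (1 + t • A).det) (Icc 0 1) :=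
    (ContinuousLinearMap.continuous_det.comp (by fun_prop)).continuousOn
  obtain ⟨t, ⟨ht0, ht1⟩, ht⟩ := intermediate_value_Icc' zero_le_one hcont
    (show (0 : ℝ) ∈ Icc _ _ from ⟨by simpa using hneg, by simp [ContinuousLinearMap.det]⟩)
  obtain ⟨x, hx, hx0⟩ := (Submodule.ne_bot_iff _).mp
    (LinearMap.bot_lt_ker_of_det_eq_zero (f := (1 + t • A).toLinearMap) ht).ne'
  have hx' : x = -(t • A x) := eq_neg_of_add_eq_zero_left hx
  have h1 : ‖x‖ ≤ ‖A‖ * ‖x‖ := calc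
    ‖x‖ = t * ‖A x‖ := by
      nth_rw 1 [hx']
      rw [norm_neg, norm_smul, Real.norm_of_nonneg ht0]
    _ ≤ 1 * ‖A x‖ := by gcongr
    _ ≤ ‖A‖ * ‖x‖ := by simpa using A.le_opNorm x
  have := norm_pos_iff.mpr hx0
  nlinarith

/-- `det (1 + t A)` is a polynomial in `t`, hence is determined by its values at finitely many
nodes. -/
theorem exists_det_one_add_smul_eq_sum [NormedSpace ℝ E] [FiniteDimensional ℝ E] (v : ℕ → ℝ)
    (hv : Function.Injective v) :
    ∃ b : ℕ → ℝ, ∑ i ∈ Finset.range (finrank ℝ E + 1), b i = 1 ∧ ∀ A : E →L[ℝ] E,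
      (1 + A).det = ∑ i ∈ Finset.range (finrank ℝ E + 1), b i * (1 + v i • A).det := by
  classical
  set s := Finset.range (finrank ℝ E + 1)
  let e := finBasis ℝ E
  have hdet : ∀ (A : E →L[ℝ] E) (t : ℝ), (1 + t • A).det = (Matrix.det
      ((Polynomial.X : Polynomial ℝ) • (LinearMap.toMatrix e e A.toLinearMap).map Polynomial.C +
        (1 : Matrix _ _ ℝ).map Polynomial.C)).eval t := by
    intro A t
    rw [← Polynomial.coe_evalRingHom, RingHom.map_det, ContinuousLinearMap.det,
      ← LinearMap.det_toMatrix e]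
    congr 1
    ext i j
    by_cases hij : i = j <;>
      simp [LinearMap.toMatrix_one, add_comm, mul_comm t, hij]
  -- The weights are the Lagrange basis polynomials at 1; they depend on the nodes alone, so they
  -- can later be pulled out of an integral over varying `A`.
  refine ⟨fun i => (Lagrange.basis s v i).eval 1, ?_, fun A => ?_⟩
  · rw [← Polynomial.eval_finsetSum, Lagrange.sum_basis hv.injOn (by simp [s]), Polynomial.eval_one]
  · have h1 := hdet A 1
    rw [one_smul] at h1
    rw [h1]
    simp only [hdet]
    set p := Matrix.det
      ((Polynomial.X : Polynomial ℝ) • (LinearMap.toMatrix e e A.toLinearMap).map Polynomial.C +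
        (1 : Matrix _ _ ℝ).map Polynomial.C) with hp
    have hdeg : p.degree < s.card := by
      have := Polynomial.natDegree_det_X_add_C_le (LinearMap.toMatrix e e A.toLinearMap) 1
      rw [Fintype.card_fin] at this
      refine Polynomial.degree_le_natDegree.trans_lt ?_
      rw [Finset.card_range]
      exact_mod_cast Nat.lt_succ_of_le this
    conv_lhs => rw [Lagrange.eq_interpolate (hv.injOn (s := (s : Set ℕ))) hdeg]
    rw [Lagrange.interpolate_apply, Polynomial.eval_finsetSum]
    refine Finset.sum_congr rfl fun i _ => ?_
    rw [Polynomial.eval_mul, Polynomial.eval_C, mul_comm]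

variable [NormedSpace ℝ E] [FiniteDimensional ℝ E] [MeasurableSpace E] [BorelSpace E]

/-- A Lipschitz map which is the identity outside the unit ball has degree one. -/
theorem setIntegral_det_one_add (μ : Measure E) [μ.IsAddHaarMeasure] {g : E → E} {K : NNReal}
    {g' : E → E →L[ℝ] E} (hg : LipschitzWith K g) (h0 : ∀ x ∉ ball (0 : E) 1, g x = 0)
    (hg' : ∀ x ∈ ball (0 : E) 1, HasFDerivAt g (g' x) x) :
    ∫ x in ball (0 : E) 1, (1 + g' x).det ∂μ = μ.real (ball (0 : E) 1) := by
  have hnorm : ∀ x ∈ ball (0 : E) 1, ‖g' x‖ ≤ K := fun x hx => (hg' x hx).le_of_lipschitz hg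
  -- For small `t` the map `x + t g x` is a bijection of `E` fixing the complement of the ball
  -- pointwise, hence a bijection of the ball with positive Jacobian; the change of variables
  -- formula gives the volume.
  have small : ∀ t : ℝ, 0 ≤ t → t * K < 1 →
      IntegrableOn (fun x => (1 + t • g' x).det) (ball (0 : E) 1) μ ∧
      ∫ x in ball (0 : E) 1, (1 + t • g' x).det ∂μ = μ.real (ball (0 : E) 1) := by
    intro t ht htK
    have hlip : LipschitzWith (⟨t, ht⟩ * K) fun x => t • g x := by
      refine LipschitzWith.of_dist_le_mul fun x y => ?_
      rw [dist_smul₀, Real.norm_of_nonneg ht]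
      have := mul_le_mul_of_nonneg_left (hg.dist_le_mul x y) ht
      rwa [← mul_assoc] at this
    have hbij := bijective_id_add_of_lipschitzWith (K := ⟨t, ht⟩ * K)
      (by rw [← NNReal.coe_lt_coe]; exact htK) hlip
    have hfix : ∀ x ∉ ball (0 : E) 1, x + t • g x = x := fun x hx => by simp [h0 x hx]
    have himg : (fun x => x + t • g x) '' ball (0 : E) 1 = ball (0 : E) 1 := by
      ext y
      constructor
      · rintro ⟨x, hx, rfl⟩
        by_contra hy
        have := hbij.1 (hfix _ hy)
        exact hy (this.symm ▸ hx)
      · intro hy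
        obtain ⟨x, hx⟩ := hbij.2 y
        refine ⟨x, ?_, hx⟩
        by_contra hxb
        have : x = y := (hfix x hxb).symm.trans hx
        exact hxb (this ▸ hy)
    have hder : ∀ x ∈ ball (0 : E) 1, HasFDerivWithinAt (fun x => x + t • g x)
        (1 + t • g' x) (ball (0 : E) 1) x := fun x hx =>
      ((hasFDerivAt_id x).add ((hg' x hx).const_smul t)).hasFDerivWithinAt
    have hpos : ∀ x ∈ ball (0 : E) 1, 0 ≤ (1 + t • g' x).det := by
      refine fun x hx => (det_one_add_pos_of_norm_lt_one ?_).le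
      rw [norm_smul, Real.norm_of_nonneg ht]
      exact (mul_le_mul_of_nonneg_left (hnorm x hx) ht).trans_lt htK
    have hi := integrableOn_image_iff_integrableOn_abs_det_fderiv_smul μ measurableSet_ball hder
      hbij.1.injOn (fun _ => (1 : ℝ))
    have he := integral_image_eq_integral_abs_det_fderiv_smul μ measurableSet_ball hder
      hbij.1.injOn (fun _ => (1 : ℝ))
    rw [himg] at hi he
    have hcongr : ∀ x ∈ ball (0 : E) 1,
        |(1 + t • g' x).det| • (1 : ℝ) = (1 + t • g' x).det := by
      intro x hx
      rw [abs_of_nonneg (hpos x hx), smul_eq_mul, mul_one]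
    rw [integrableOn_congr_fun hcongr measurableSet_ball] at hi
    rw [setIntegral_congr_fun measurableSet_ball hcongr] at he
    refine ⟨hi.mp ?_, ?_⟩
    · exact integrableOn_const (by exact measure_ball_lt_top.ne)
    · rw [← he]
      simp
  -- Distinct nodes, all small enough for `small`; interpolation then carries the constant value of
  -- the integral to `t = 1`.
  set v : ℕ → ℝ := fun i => 1 / (((i : ℝ) + 1) * (K + 1)) with hv
  have hvinj : Function.Injective v := by
    intro i j hij
    have hK : (0 : ℝ) < K + 1 := by positivity
    simp only [hv, one_div, inv_inj] at hij
    have := mul_right_cancel₀ hK.ne' hij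
    exact_mod_cast add_right_cancel this
  have hsmall : ∀ i, 0 ≤ v i ∧ v i * K < 1 := by
    intro i
    refine ⟨by positivity, ?_⟩
    rw [hv]
    simp only
    rw [one_div, inv_mul_lt_iff₀ (by positivity)]
    have : (0 : ℝ) ≤ i := by positivity
    have hK := K.coe_nonneg
    nlinarith
  obtain ⟨b, hb, hdet⟩ := exists_det_one_add_smul_eq_sum (E := E) v hvinj
  rw [integral_congr_ae (ae_of_all _ fun x => hdet (g' x)), integral_finsetSum]
  · simp only [integral_const_mul, fun i => (small (v i) (hsmall i).1 (hsmall i).2).2]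
    rw [← Finset.sum_mul, hb, one_mul]
  · intro i _
    exact (small (v i) (hsmall i).1 (hsmall i).2).1.const_mul _

end Brouwer

/-! ### No retraction, zeros of perturbed identities, invariance of domain -/

section InvarianceOfDomain

open MeasureTheory Metric Set Module
open scoped Topology

variable {E : Type*} [NormedAddCommGroup E] [InnerProductSpace ℝ E] [FiniteDimensional ℝ E]

/-- There is no `C¹` retraction of the ball onto the sphere, stated for a nowhere vanishing map that
restricts to the identity of the sphere. -/
theorem exists_eq_zero_of_contDiff {H : E → E} (hH : ContDiff ℝ 1 H)
    (hid : ∀ x : E, ‖x‖ = 1 → H x = x) : ∃ x, H x = 0 := by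
  by_contra! hne
  borelize E
  set R : E → E := fun x => ‖H x‖⁻¹ • H x with hR
  have hRc : ContDiff ℝ 1 R :=
    ((hH.norm ℝ hne).inv fun x => norm_ne_zero_iff.mpr (hne x)).smul hH
  have hRn : ∀ x, ‖R x‖ = 1 := fun x => by
    simp [hR, norm_smul, inv_mul_cancel₀ (norm_ne_zero_iff.mpr (hne x))]
  have hRid : ∀ x : E, ‖x‖ = 1 → R x - x = 0 := fun x hx => by simp [hR, hid x hx, hx]
  obtain ⟨K, hK⟩ := ((hRc.sub contDiff_id).contDiffOn (s := closedBall (0 : E) 1)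
    ).exists_lipschitzOnWith one_ne_zero (convex_closedBall _ _) (isCompact_closedBall _ _)
  classical
  set g : E → E := fun x => if ‖x‖ ≤ 1 then R x - x else 0 with hg
  -- Lipschitz estimate across the sphere: compare `x` with the radial projection `z` of `y`, where
  -- `R z - z` vanishes. Passing from `‖x - z‖` to `‖x - y‖` costs the factor 2.
  have cross : ∀ x y : E, ‖x‖ ≤ 1 → 1 < ‖y‖ → ‖R x - x‖ ≤ 2 * K * ‖x - y‖ := by
    intro x y hx hy
    have hy0 : 0 < ‖y‖ := one_pos.trans hy
    set z := ‖y‖⁻¹ • y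
    have hz : ‖z‖ = 1 := by simp [z, norm_smul, hy0.ne']
    have h1 := hK.dist_le_mul x (by simpa using hx) z (by simp [hz])
    simp only [id, dist_eq_norm, hRid z hz, sub_zero] at h1
    have h2 : ‖y - z‖ = ‖y‖ - 1 := by
      have : y - z = (1 - ‖y‖⁻¹) • y := by rw [sub_smul, one_smul]
      rw [this, norm_smul, Real.norm_of_nonneg (sub_nonneg.mpr (inv_le_one_of_one_le₀ hy.le)),
        sub_mul, one_mul, inv_mul_cancel₀ hy0.ne']
    have h3 : ‖x - z‖ ≤ 2 * ‖x - y‖ := by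
      have h4 : ‖x - z‖ ≤ ‖x - y‖ + ‖y - z‖ := norm_sub_le_norm_sub_add_norm_sub x y z
      have h5 : ‖y‖ - ‖x‖ ≤ ‖x - y‖ := by
        rw [norm_sub_rev]
        exact norm_sub_norm_le y x
      linarith
    calc _ ≤ K * ‖x - z‖ := h1
      _ ≤ K * (2 * ‖x - y‖) := by gcongr
      _ = _ := by ring
  have hlip : LipschitzWith (2 * K) g := by
    refine LipschitzWith.of_dist_le_mul fun x y => ?_
    rw [NNReal.coe_mul, NNReal.coe_ofNat, dist_eq_norm, dist_eq_norm]
    by_cases hx : ‖x‖ ≤ 1 <;> by_cases hy : ‖y‖ ≤ 1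
    · simp only [hg, hx, hy, if_true]
      have := hK.dist_le_mul x (by simpa using hx) y (by simpa using hy)
      simp only [id, dist_eq_norm] at this
      refine this.trans ?_
      have : 0 ≤ K * ‖x - y‖ := by positivity
      linarith
    · simp only [hg, hx, hy, if_true, if_false, sub_zero]
      exact cross x y hx (not_le.mp hy)
    · simp only [hg, hx, hy, if_true, if_false, zero_sub, norm_neg]
      rw [norm_sub_rev x]
      exact cross y x hy (not_le.mp hx)
    · simp only [hg, hx, hy, if_false, sub_zero, norm_zero]
      positivity
  have h0 : ∀ x ∉ ball (0 : E) 1, g x = 0 := by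
    intro x hx
    have hx1 : 1 ≤ ‖x‖ := by simpa using hx
    by_cases hx' : ‖x‖ ≤ 1
    · simp [hg, hx', hRid x (le_antisymm hx' hx1)]
    · simp [hg, hx']
  have hder : ∀ x ∈ ball (0 : E) 1, HasFDerivAt g (fderiv ℝ R x - 1) x := by
    intro x hx
    have h1 : HasFDerivAt (fun x => R x - x) (fderiv ℝ R x - 1) x :=
      (hRc.differentiable one_ne_zero x).hasFDerivAt.sub (hasFDerivAt_id x)
    refine h1.congr_of_eventuallyEq ?_
    filter_upwards [isOpen_ball.mem_nhds hx] with y hy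
    have : ‖y‖ ≤ 1 := by simpa using (mem_ball_zero_iff.mp hy).le
    simp [hg, this]
  have hint := setIntegral_det_one_add (volume : Measure E) hlip h0 hder
  -- Since `‖R‖²` is constant, the range of the derivative is orthogonal to `R x`, so it misses the
  -- nonzero vector `R x`.
  have hdet : ∀ x, (1 + (fderiv ℝ R x - 1)).det = 0 := by
    intro x
    rw [add_sub_cancel]
    by_contra hne0
    have hd := (hRc.differentiable one_ne_zero x).hasFDerivAt
    have h1 := hd.norm_sq
    simp only [hRn, one_pow] at h1
    have h2 := h1.unique (hasFDerivAt_const (1 : ℝ) x)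
    have hsurj := (LinearMap.isUnit_iff_range_eq_top _).mp
      ((LinearMap.isUnit_iff_isUnit_det (fderiv ℝ R x).toLinearMap).mpr (isUnit_iff_ne_zero.mpr hne0))
    obtain ⟨v, hv⟩ := LinearMap.range_eq_top.mp hsurj (R x)
    have h3 := congrArg (fun φ : E →L[ℝ] ℝ => φ v) h2
    have hv' : fderiv ℝ R x v = R x := hv
    simp [hv', hRn] at h3
  simp only [hdet, integral_zero] at hint
  have hpos : 0 < (volume : Measure E).real (ball (0 : E) 1) :=
    ENNReal.toReal_pos (measure_ball_pos _ _ one_pos).ne' measure_ball_lt_top.ne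
  exact hpos.ne hint

/-- A nowhere zero `F` could be deformed to the identity near the sphere and smoothed without
acquiring zeros, contradicting `exists_eq_zero_of_contDiff`. -/
theorem exists_eq_zero_of_norm_sub_le {F : E → E} (hF : ContinuousOn F (closedBall 0 1))
    (h : ∀ x ∈ closedBall (0 : E) 1, ‖F x - x‖ ≤ 1 / 2) : ∃ x ∈ closedBall (0 : E) 1, F x = 0 := by
  by_contra! hne
  have : TietzeExtension E := TietzeExtension.of_tvs ℝ
  obtain ⟨G, hG⟩ := ContinuousMap.exists_restrict_eq (isClosed_closedBall (x := (0 : E)) (ε := 1))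
    ⟨_, hF.domRestrict⟩
  have hGF : ∀ x ∈ closedBall (0 : E) 1, G x = F x := fun x hx =>
    congrArg (fun φ : C(closedBall (0 : E) 1, E) => φ ⟨x, hx⟩) hG
  -- Cutoff equal to 1 up to radius 7/10 and to 0 from radius 8/10. In the shell between, the
  -- displacement is at most 1/2 < 7/10, so no zero appears.
  set χ : E → ℝ := fun x => max 0 (min 1 (8 - 10 * ‖x‖)) with hχ
  have hχ0 : ∀ x, 0 ≤ χ x := fun x => le_max_left _ _
  have hχ1 : ∀ x, χ x ≤ 1 := fun x => max_le zero_le_one (min_le_left _ _)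
  have hχout : ∀ x : E, 8 / 10 ≤ ‖x‖ → χ x = 0 := fun x hx =>
    max_eq_left ((min_le_right _ _).trans (by linarith))
  have hχin : ∀ x : E, ‖x‖ ≤ 7 / 10 → χ x = 1 := fun x hx => by
    simp only [hχ]
    rw [min_eq_left (by linarith), max_eq_right zero_le_one]
  set H₀ : E → E := fun x => x + χ x • (G x - x) with hH₀
  have hc : Continuous H₀ := by fun_prop
  have hH₀id : ∀ x : E, 8 / 10 ≤ ‖x‖ → H₀ x = x := fun x hx => by simp [hH₀, hχout x hx]
  have hH₀ne : ∀ x, H₀ x ≠ 0 := by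
    intro x hx
    rcases le_or_gt (‖x‖) (7 / 10) with h1 | h1
    · have hxb : x ∈ closedBall (0 : E) 1 := by simpa using h1.trans (by norm_num)
      simp only [hH₀, hχin x h1, one_smul, add_sub_cancel, hGF x hxb] at hx
      exact hne x hxb hx
    rcases le_or_gt (8 / 10) (‖x‖) with h2 | h2
    · rw [hH₀id x h2] at hx
      rw [hx, norm_zero] at h1
      norm_num at h1
    · have hxb : x ∈ closedBall (0 : E) 1 := by simpa using h2.le.trans (by norm_num)
      have h3 : ‖x‖ = ‖χ x • (G x - x)‖ := by
        nth_rw 1 [eq_neg_of_add_eq_zero_left hx]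
        rw [norm_neg]
      rw [norm_smul, Real.norm_of_nonneg (hχ0 x), hGF x hxb] at h3
      have := mul_le_mul (hχ1 x) (h x hxb) (norm_nonneg _) zero_le_one
      linarith
  -- The permitted error at `x` is `‖H₀ x‖`, with strict inequality, so the smooth map cannot vanish
  -- either; it stays the identity outside the open unit ball.
  obtain ⟨H, hHc, hHd, hHe, -⟩ := hc.exists_contDiff_approx_and_eqOn 1 hc.norm
    (fun x => norm_pos_iff.mpr (hH₀ne x)) (S := {x | 1 ≤ ‖x‖}) (U := {x | 8 / 10 < ‖x‖})
    (isClosed_le continuous_const continuous_norm)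
    ((isOpen_lt continuous_const continuous_norm).mem_nhdsSet.mpr fun x (hx : 1 ≤ ‖x‖) =>
      show 8 / 10 < ‖x‖ by linarith)
    (contDiffOn_id.congr fun x hx => hH₀id x (le_of_lt hx))
  obtain ⟨x, hx⟩ := exists_eq_zero_of_contDiff (H := H) (by exact_mod_cast hHc) fun x hx => by
    rw [hHe (show 1 ≤ ‖x‖ from hx.ge), hH₀id x (by rw [hx]; norm_num)]
  have := hHd x
  rw [hx, dist_zero_left] at this
  exact this.false

/-- Extend the inverse of `f` to a continuous `G`. If `f 0` were not interior to the image, `G`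
could be perturbed to lose its zero on the image: points near `f 0` are pushed radially from a
missed point `c` onto a small sphere, whose image under a smooth approximation of `G` is null and so
misses some small `v`. Composing with `f` gives a zero-free map close to the identity. -/
theorem image_closedBall_one_mem_nhds {f : E → E} (hf : ContinuousOn f (closedBall 0 1))
    (hinj : InjOn f (closedBall 0 1)) : f '' closedBall 0 1 ∈ 𝓝 (f 0) := by
  by_contra hnot
  borelize E
  have : TietzeExtension E := TietzeExtension.of_tvs ℝ
  set B := closedBall (0 : E) 1 with hB
  have h0B : (0 : E) ∈ B := by simp [hB]
  have : CompactSpace B := isCompact_iff_compactSpace.mp (isCompact_closedBall _ _)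
  obtain ⟨G, hG⟩ := ContinuousMap.exists_extension' (e := B.domRestrict f)
    (hf.domRestrict.isClosedEmbedding hinj.injective) ⟨_, continuous_subtype_val⟩
  have hGf : ∀ x ∈ B, G (f x) = x := fun x hx => congrFun hG ⟨x, hx⟩
  obtain ⟨ε, hε, hGε⟩ : ∃ ε > 0, ∀ y, dist y (f 0) < 2 * ε → ‖G y‖ < 1 / 10 := by
    obtain ⟨ε, hε, h⟩ := Metric.continuousAt_iff.mp (G.continuous.continuousAt (x := f 0)) (1 / 10)
      (by norm_num)
    refine ⟨ε / 2, by positivity, fun y hy => ?_⟩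
    have := h (x := y) (by linarith)
    rwa [hGf 0 h0B, dist_zero_right] at this
  obtain ⟨c, hcε, hcK⟩ : ∃ c, dist c (f 0) < ε ∧ c ∉ f '' B := by
    by_contra! hall
    exact hnot (Metric.mem_nhds_iff.mpr ⟨ε, hε, fun c hc => hall c hc⟩)
  have hGc : ∀ y, ‖y - c‖ ≤ ε → ‖G y‖ < 1 / 10 := fun y hy => hGε y (by
    have := dist_triangle y c (f 0)
    rw [dist_eq_norm y c] at this
    linarith)
  have hKc : IsCompact (f '' B) := (isCompact_closedBall _ _).image_of_continuousOn hf
  set Z := f '' B ∩ {y | ε ≤ ‖y - c‖}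
  have hZ : IsCompact Z := hKc.inter_right (isClosed_le continuous_const (by fun_prop))
  -- On the image, `G` vanishes only at `f 0`, which lies within `ε` of `c`.
  have hZne : ∀ y ∈ Z, G y ≠ 0 := by
    rintro _ ⟨⟨x, hx, rfl⟩, hy⟩ h
    rw [hGf x hx] at h
    rw [mem_ofPred_eq, h, ← dist_eq_norm, dist_comm] at hy
    exact hy.not_gt hcε
  obtain ⟨δ, hδ, hδ1, hGδ⟩ : ∃ δ > 0, δ ≤ 1 / 10 ∧ ∀ y ∈ Z, δ ≤ ‖G y‖ := by
    rcases Z.eq_empty_or_nonempty with he | hn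
    · exact ⟨1 / 10, by norm_num, le_rfl, by simp [he]⟩
    · obtain ⟨y, hy, hmin⟩ := hZ.exists_isMinOn hn G.continuous.norm.continuousOn
      exact ⟨min (‖G y‖) (1 / 10), lt_min (norm_pos_iff.mpr (hZne y hy)) (by norm_num),
        min_le_right _ _, fun z hz => (min_le_left _ _).trans (hmin hz)⟩
  obtain ⟨P, hP, hPG, -⟩ := G.continuous.exists_contDiff_approx 1 (ε := fun _ => δ / 2)
    continuous_const (fun _ => by positivity)
  have hnull : (volume : Measure E) (P '' sphere c ε) = 0 :=
    addHaar_image_eq_zero_of_differentiableOn_of_addHaar_eq_zero _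
      (hP.differentiable (by simp)).differentiableOn (Measure.addHaar_sphere_of_ne_zero _ _ hε.ne')
  obtain ⟨v, hv, hvP⟩ : ∃ v ∈ ball (0 : E) (δ / 2), v ∉ P '' sphere c ε := by
    by_contra! hsub
    exact (measure_ball_pos (volume : Measure E) 0 (half_pos hδ)).ne' (measure_mono_null hsub hnull)
  rw [mem_ball_zero_iff] at hv
  have hQ : ∀ y, ‖(P y - v) - G y‖ < δ := by
    intro y
    have h1 := hPG y
    rw [dist_eq_norm] at h1
    have h2 : (P y - v) - G y = (P y - G y) - v := by abel
    rw [h2]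
    linarith [norm_sub_le (P y - G y) v]
  -- Radial push from `c`: the punctured `ε`-ball goes to its boundary sphere, everything farther is
  -- fixed.
  set Φ : E → E := fun y => c + max (ε / ‖y - c‖) 1 • (y - c) with hΦ
  have hfc : ∀ x ∈ B, ‖f x - c‖ ≠ 0 := fun x hx h =>
    hcK ⟨x, hx, sub_eq_zero.mp (norm_eq_zero.mp h)⟩
  have hΦfar : ∀ y, ε ≤ ‖y - c‖ → Φ y = y := by
    intro y hy
    simp only [hΦ]
    rw [max_eq_right ((div_le_one (hε.trans_le hy)).mpr hy), one_smul, add_sub_cancel]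
  have hΦnear : ∀ y, ‖y - c‖ ≠ 0 → ‖y - c‖ ≤ ε → ‖Φ y - c‖ = ε := by
    intro y hy0 hy
    have hpos := (norm_nonneg (y - c)).lt_of_ne' hy0
    simp only [hΦ]
    rw [max_eq_left ((one_le_div hpos).mpr hy), add_sub_cancel_left, norm_smul,
      Real.norm_of_nonneg (by positivity), div_mul_cancel₀ _ hy0]
  obtain ⟨x, hx, hx0⟩ := exists_eq_zero_of_norm_sub_le (F := fun x => P (Φ (f x)) - v) (by
      refine (hP.continuous.comp_continuousOn ?_).sub continuousOn_const
      have hsub : ContinuousOn (fun x => f x - c) B := hf.sub continuousOn_const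
      exact continuousOn_const.add
        (((continuousOn_const.div hsub.norm hfc).sup continuousOn_const).smul hsub)) (by
      intro x hx
      have h1 := hQ (Φ (f x))
      rcases le_total ε (‖f x - c‖) with h | h
      · rw [hΦfar _ h, hGf x hx] at h1
        change ‖P (Φ (f x)) - v - x‖ ≤ _
        rw [hΦfar _ h]
        linarith
      · have h2 := hGc (Φ (f x)) (hΦnear _ (hfc x hx) h).le
        have h3 := hGc (f x) h
        rw [hGf x hx] at h3
        have h4 : P (Φ (f x)) - v - x = (P (Φ (f x)) - v - G (Φ (f x))) + (G (Φ (f x)) - x) := by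
          abel
        change ‖P (Φ (f x)) - v - x‖ ≤ _
        rw [h4]
        linarith [norm_add_le (P (Φ (f x)) - v - G (Φ (f x))) (G (Φ (f x)) - x),
          norm_sub_le (G (Φ (f x))) x])
  have hx0' : P (Φ (f x)) = v := sub_eq_zero.mp hx0
  -- A zero far from `c` contradicts the lower bound `δ` for `G` on `Z`; a zero near `c` puts `v` in
  -- the image of the sphere.
  rcases le_total ε (‖f x - c‖) with h | h
  · have h1 := hQ (Φ (f x))
    rw [hx0', sub_self, zero_sub, norm_neg, hΦfar _ h] at h1
    exact (hGδ _ ⟨⟨x, hx, rfl⟩, h⟩).not_gt h1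
  · exact hvP ⟨Φ (f x), by simpa [dist_eq_norm] using hΦnear _ (hfc x hx) h, hx0'⟩

/-- Invariance of domain at the centre of a ball. -/
theorem image_closedBall_mem_nhds {f : E → E} {r : ℝ} (hr : 0 < r)
    (hf : ContinuousOn f (closedBall 0 r)) (hinj : InjOn f (closedBall 0 r)) :
    f '' closedBall 0 r ∈ 𝓝 (f 0) := by
  have hmaps : MapsTo (fun x : E => r • x) (closedBall 0 1) (closedBall 0 r) := by
    intro x hx
    have hx' : ‖x‖ ≤ 1 := by simpa using hx
    simpa [norm_smul, abs_of_pos hr] using mul_le_of_le_one_right hr.le hx'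
  have h := image_closedBall_one_mem_nhds (f := fun x => f (r • x))
    (hf.comp (by fun_prop) hmaps)
    (fun x hx y hy hxy => smul_right_injective E hr.ne' (hinj (hmaps hx) (hmaps hy) hxy))
  simp only [smul_zero] at h
  refine Filter.mem_of_superset h ?_
  rintro _ ⟨x, hx, rfl⟩
  exact ⟨r • x, hmaps hx, rfl⟩

end InvarianceOfDomain

/-! ### Invariance of domain in a topological sphere -/

section Sphere

open Metric Set Module
open scoped Topology

/-- A ball of dimension `n` embedded in a space homeomorphic to the `n`-sphere is a neighbourhood
of its centre. -/
theorem image_closedBall_mem_nhds_of_homeomorph_sphere {X : Type*} [TopologicalSpace X] {n : ℕ}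
    (h : X ≃ₜ sphere (0 : EuclideanSpace ℝ (Fin (n + 1))) 1) {φ : EuclideanSpace ℝ (Fin n) → X}
    {r : ℝ} (hr : 0 < r) (hφ : ContinuousOn φ (closedBall 0 r))
    (hinj : InjOn φ (closedBall 0 r)) : φ '' closedBall 0 r ∈ 𝓝 (φ 0) := by
  have : Fact (finrank ℝ (EuclideanSpace ℝ (Fin (n + 1))) = n + 1) := ⟨by simp⟩
  -- Projecting from the antipode puts `h (φ 0)` in the chart; a smaller ball then maps wholly into
  -- it.
  set e := stereographic' n (-(h (φ 0)))
  have he0 : h (φ 0) ∈ e.source := by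
    rw [stereographic'_source, mem_compl_singleton_iff]
    exact ne_neg_of_mem_unit_sphere ℝ _
  have hsrc : h ⁻¹' e.source ∈ 𝓝 (φ 0) :=
    h.continuous.continuousAt.preimage_mem_nhds (e.open_source.mem_nhds he0)
  obtain ⟨δ, hδ, hδs⟩ := Metric.mem_nhds_iff.mp
    ((hφ.continuousAt (closedBall_mem_nhds 0 hr)).preimage_mem_nhds hsrc)
  obtain ⟨ρ, hρ, hρr, hρδ⟩ : ∃ ρ > 0, ρ ≤ r ∧ ρ < δ :=
    ⟨min r (δ / 2), lt_min hr (half_pos hδ), min_le_left _ _,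
      (min_le_right _ _).trans_lt (half_lt_self hδ)⟩
  have hsub : closedBall (0 : EuclideanSpace ℝ (Fin n)) ρ ⊆ closedBall 0 r :=
    closedBall_subset_closedBall hρr
  have hmaps : ∀ u ∈ closedBall (0 : EuclideanSpace ℝ (Fin n)) ρ, h (φ u) ∈ e.source :=
    fun u hu => hδs (closedBall_subset_ball hρδ hu)
  have key := image_closedBall_mem_nhds (f := fun u => e (h (φ u))) hρ
    (e.continuousOn.comp (h.continuous.comp_continuousOn (hφ.mono hsub)) hmaps)
    (fun u hu v hv huv => hinj (hsub hu) (hsub hv)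
      (h.injective (e.injOn (hmaps u hu) (hmaps v hv) huv)))
  have hcont : ContinuousAt (fun q => e (h q)) (φ 0) :=
    (e.continuousAt he0).comp h.continuous.continuousAt
  filter_upwards [hcont.preimage_mem_nhds key, hsrc] with q hq hqs
  obtain ⟨u, hu, huq⟩ := hq
  exact ⟨u, hsub hu, h.injective (e.injOn (hmaps u hu) hqs huq)⟩

/-- Version for a sphere sitting inside an ambient space, as a geometric realization does. Off the
ball, `φ` is replaced by the constant `φ 0` to make it land in `Y`. -/
theorem image_closedBall_mem_nhdsWithin_of_homeomorph_sphere {F : Type*} [TopologicalSpace F]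
    {Y : Set F} {n : ℕ} (h : Y ≃ₜ sphere (0 : EuclideanSpace ℝ (Fin (n + 1))) 1)
    {φ : EuclideanSpace ℝ (Fin n) → F} {r : ℝ} (hr : 0 < r)
    (hφ : ContinuousOn φ (closedBall 0 r)) (hinj : InjOn φ (closedBall 0 r))
    (hY : MapsTo φ (closedBall 0 r) Y) : φ '' closedBall 0 r ∈ 𝓝[Y] (φ 0) := by
  classical
  have h0 : (0 : EuclideanSpace ℝ (Fin n)) ∈ closedBall 0 r := mem_closedBall_self hr.le
  set ψ : EuclideanSpace ℝ (Fin n) → Y := fun u =>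
    if hu : u ∈ closedBall 0 r then ⟨φ u, hY hu⟩ else ⟨φ 0, hY h0⟩
  have hψ : ∀ u ∈ closedBall 0 r, (ψ u : F) = φ u := fun u hu => by simp only [ψ, dif_pos hu]
  have key := image_closedBall_mem_nhds_of_homeomorph_sphere h (φ := ψ) hr
    (Topology.IsInducing.subtypeVal.continuousOn_iff.mpr (hφ.congr hψ))
    (fun u hu v hv huv => hinj hu hv (by rw [← hψ u hu, ← hψ v hv, huv]))
  have h0' : ψ 0 = ⟨φ 0, hY h0⟩ := Subtype.ext (hψ 0 h0)
  rw [h0'] at key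
  rw [mem_nhdsWithin_iff_exists_mem_nhds_inter]
  obtain ⟨U, hU, hUs⟩ := mem_nhds_subtype _ _ _ |>.mp key
  refine ⟨U, hU, fun q hq => ?_⟩
  obtain ⟨u, hu, huq⟩ := hUs (show (⟨q, hq.2⟩ : Y) ∈ _ from hq.1)
  exact ⟨u, hu, by rw [← hψ u hu, huq]⟩

end Sphere

/-! ### Tetrahedra around a triangle of a triangulated 3-sphere -/

namespace AbstractSimplicialComplex

open Metric Set
open scoped Topology

variable {S : Type*} [Fintype S] [DecidableEq S]

/-- In a triangulated `3`-sphere, two tetrahedra sharing a triangle are the only maximal simplices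
containing this triangle. -/
theorem IsTriangulationOfSphere.subset_or_subset {L : AbstractSimplicialComplex S}
    (hL : L.IsTriangulationOfSphere 3) {τ σ : Finset S} {a b : S} (hτ : τ.card = 3)
    (ha : a ∉ τ) (hb : b ∉ τ) (hab : a ≠ b) (haL : insert a τ ∈ L) (hbL : insert b τ ∈ L)
    (hσL : σ ∈ L) (hτσ : τ ⊆ σ) : σ ⊆ insert a τ ∨ σ ⊆ insert b τ := by
  by_contra! hcon
  obtain ⟨h⟩ := hL
  obtain ⟨x, y, z, hxy, hxz, hyz, rfl⟩ := Finset.card_eq_three.mp hτ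
  simp only [Finset.mem_insert, Finset.mem_singleton, not_or] at ha hb
  obtain ⟨hax, hay, haz⟩ := ha
  obtain ⟨hbx, hby, hbz⟩ := hb
  -- Barycentric coordinates on the two glued tetrahedra, centred at the barycentre of the triangle:
  -- `u 2` is the weight of `a` when positive, minus that of `b` when negative, and `z` absorbs the
  -- remainder.
  set φ : EuclideanSpace ℝ (Fin 3) → S → ℝ := fun u =>
    Pi.single x (1 / 3 + u 0) + Pi.single y (1 / 3 + u 1) +
      Pi.single z (1 / 3 - u 0 - u 1 - |u 2|) + Pi.single a (max (u 2) 0) +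
      Pi.single b (max (-u 2) 0) with hφ
  have φx : ∀ u, φ u x = 1 / 3 + u 0 := fun u => by
    simp [hφ, hxy, hxz, Ne.symm hax, Ne.symm hbx]
  have φy : ∀ u, φ u y = 1 / 3 + u 1 := fun u => by
    simp [hφ, hxy.symm, hyz, Ne.symm hay, Ne.symm hby]
  have φz : ∀ u, φ u z = 1 / 3 - u 0 - u 1 - |u 2| := fun u => by
    simp [hφ, hxz.symm, hyz.symm, Ne.symm haz, Ne.symm hbz]
  have φa : ∀ u, φ u a = max (u 2) 0 := fun u => by
    simp [hφ, hax, hay, haz, hab]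
  have φb : ∀ u, φ u b = max (-u 2) 0 := fun u => by
    simp [hφ, hbx, hby, hbz, hab.symm]
  have φo : ∀ u s, s ≠ x → s ≠ y → s ≠ z → s ≠ a → s ≠ b → φ u s = 0 :=
    fun u s h1 h2 h3 h4 h5 => by simp [hφ, h1, h2, h3, h4, h5]
  have hcont : Continuous φ := by
    have h1 (s : S) : Continuous fun t : ℝ => (Pi.single s t : S → ℝ) :=
      continuous_single (A := fun _ : S => ℝ) s
    exact (((((h1 x).comp (by fun_prop)).add ((h1 y).comp (by fun_prop))).add
      ((h1 z).comp (by fun_prop))).add ((h1 a).comp (by fun_prop))).add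
      ((h1 b).comp (by fun_prop))
  have hinj : Function.Injective φ := by
    intro u v huv
    have e0 := congrFun huv x
    have e1 := congrFun huv y
    have ea := congrFun huv a
    have eb := congrFun huv b
    rw [φx, φx] at e0
    rw [φy, φy] at e1
    rw [φa, φa] at ea
    rw [φb, φb] at eb
    have e2 : u 2 = v 2 := by
      have hmax (t : ℝ) : max t 0 - max (-t) 0 = t := by
        rcases le_total 0 t with ht | ht
        · rw [max_eq_left ht, max_eq_right (by linarith)]; ring
        · rw [max_eq_right ht, max_eq_left (by linarith)]; ring
      rw [← hmax (u 2), ea, eb, hmax]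
    ext i
    fin_cases i
    · simpa using e0
    · simpa using e1
    · exact e2
  have hsum : ∀ u, ∑ s, φ u s = 1 := by
    intro u
    have : max (u 2) 0 + max (-u 2) 0 = |u 2| := by
      rcases le_total 0 (u 2) with ht | ht
      · rw [max_eq_left ht, max_eq_right (by linarith), abs_of_nonneg ht, add_zero]
      · rw [max_eq_right ht, max_eq_left (by linarith), abs_of_nonpos ht, zero_add]
    simp only [hφ, Pi.add_apply, Finset.sum_add_distrib, Finset.sum_pi_single', Finset.mem_univ,
      if_true]
    linarith
  -- Radius 1/9 keeps the coordinate at `z` nonnegative: it is at least 1/3 - 3/9.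
  have hmaps : MapsTo φ (closedBall 0 (1 / 9)) L.realization := by
    intro u hu
    have hn : ‖u‖ ≤ 1 / 9 := by simpa using hu
    have hco : ∀ i, |u i| ≤ 1 / 9 := fun i => (PiLp.norm_apply_le u i).trans hn
    refine ⟨⟨fun s => ?_, hsum u⟩, ?_⟩
    · by_cases h1 : s = x
      · rw [h1, φx]; linarith [abs_le.mp (hco 0)]
      by_cases h2 : s = y
      · rw [h2, φy]; linarith [abs_le.mp (hco 1)]
      by_cases h3 : s = z
      · rw [h3, φz]; linarith [abs_le.mp (hco 0), abs_le.mp (hco 1), hco 2]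
      by_cases h4 : s = a
      · rw [h4, φa]; exact le_max_right _ _
      by_cases h5 : s = b
      · rw [h5, φb]; exact le_max_right _ _
      rw [φo u s h1 h2 h3 h4 h5]
    · rcases le_total 0 (u 2) with ht | ht
      · refine ⟨_, haL, fun s hs => ?_⟩
        simp only [Finset.mem_insert, Finset.mem_singleton, not_or] at hs
        by_cases h5 : s = b
        · rw [h5, φb, max_eq_right (by linarith)]
        · exact φo u s hs.2.1 hs.2.2.1 hs.2.2.2 hs.1 h5
      · refine ⟨_, hbL, fun s hs => ?_⟩
        simp only [Finset.mem_insert, Finset.mem_singleton, not_or] at hs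
        by_cases h5 : s = a
        · rw [h5, φa, max_eq_right ht]
        · exact φo u s hs.2.1 hs.2.2.1 hs.2.2.2 h5 hs.1
  have key := image_closedBall_mem_nhdsWithin_of_homeomorph_sphere h (by norm_num)
    hcont.continuousOn hinj.injOn hmaps
  have hφ0 := hmaps (mem_closedBall_self (by norm_num))
  have hσ : σ.Nonempty := ⟨x, hτσ (by simp)⟩
  have hσ0 : (0 : ℝ) < σ.card := by exact_mod_cast hσ.card_pos
  set q : S → ℝ := fun s => if s ∈ σ then (σ.card : ℝ)⁻¹ else 0 with hq
  have hqs : q ∈ stdSimplex ℝ S := by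
    refine ⟨fun s => ?_, ?_⟩
    · simp only [hq]
      split_ifs <;> positivity
    · simp [hq, Finset.sum_ite_mem, hσ0.ne']
  -- The segment towards the barycentre of `σ` stays in `σ`, hence in the realization. Near its
  -- start it lies in the image of `φ`, yet all its coordinates on `σ` are positive. Leaving both
  -- tetrahedra would make those at `a` and `b` positive at once.
  have hcurve : Filter.Tendsto (fun t : ℝ => (1 - t) • φ 0 + t • q) (𝓝[Ioo 0 1] 0)
      (𝓝[L.realization] (φ 0)) := by
    refine tendsto_nhdsWithin_iff.mpr ⟨?_, ?_⟩
    · have : Continuous fun t : ℝ => (1 - t) • φ 0 + t • q := by fun_prop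
      have h1 := this.tendsto 0
      simp only [sub_zero, one_smul, zero_smul, add_zero] at h1
      exact h1.mono_left nhdsWithin_le_nhds
    · filter_upwards [self_mem_nhdsWithin] with t ht
      refine ⟨convex_stdSimplex ℝ S hφ0.1 hqs (by linarith [ht.2]) ht.1.le (by ring), σ, hσL,
        fun s hs => ?_⟩
      have hsn : s ≠ x ∧ s ≠ y ∧ s ≠ z := by
        refine ⟨?_, ?_, ?_⟩ <;> rintro rfl <;> exact hs (hτσ (by simp))
      have h0 : φ 0 s = 0 := by
        by_cases h4 : s = a
        · rw [h4, φa]; simp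
        by_cases h5 : s = b
        · rw [h5, φb]; simp
        exact φo 0 s hsn.1 hsn.2.1 hsn.2.2 h4 h5
      simp [h0, hq, hs]
  have : (𝓝[Ioo (0 : ℝ) 1] 0).NeBot := left_nhdsWithin_Ioo_neBot zero_lt_one
  obtain ⟨t, ⟨u, -, hu⟩, ht⟩ := ((hcurve.eventually key).and self_mem_nhdsWithin).exists
  have hpos : ∀ s ∈ σ, 0 < φ u s := by
    intro s hs
    rw [hu]
    have h1 : 0 ≤ (1 - t) * φ 0 s := mul_nonneg (by linarith [ht.2]) (hφ0.1.1 s)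
    have h2 : 0 < t * (σ.card : ℝ)⁻¹ := mul_pos ht.1 (inv_pos.mpr hσ0)
    simp only [Pi.add_apply, Pi.smul_apply, smul_eq_mul, hq, if_pos hs]
    linarith
  obtain ⟨c, hcσ, hc⟩ := Finset.not_subset.mp hcon.1
  obtain ⟨d, hdσ, hd⟩ := Finset.not_subset.mp hcon.2
  simp only [Finset.mem_insert, Finset.mem_singleton, not_or] at hc hd
  have hcb : c = b := by
    by_contra hne
    exact (hpos c hcσ).ne' (φo u c hc.2.1 hc.2.2.1 hc.2.2.2 hc.1 hne)
  have hda : d = a := by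
    by_contra hne
    exact (hpos d hdσ).ne' (φo u d hd.2.1 hd.2.2.1 hd.2.2.2 hne hd.1)
  have h1 := hpos c hcσ
  have h2 := hpos d hdσ
  rw [hcb, φb, lt_max_iff] at h1
  rw [hda, φa, lt_max_iff] at h2
  rcases h1 with h1 | h1 <;> rcases h2 with h2 | h2 <;> linarith

end AbstractSimplicialComplex

/-! ### Cells at a vertex and relative cells of a ruin -/

namespace CoxeterSystem

variable {S W : Type*} [Group W] {M : CoxeterMatrix S} {cs : CoxeterSystem M W}

namespace Cell

/-- The cell of type `U` containing the vertex `w`. -/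
def ofVertex (w : W) (U : Finset S) (hU : cs.IsSpherical U) : cs.Cell :=
  ⟨U, hU, (w : W ⧸ cs.special U)⟩

theorem mem_vertices_ofVertex (w : W) {U : Finset S} (hU : cs.IsSpherical U) :
    w ∈ (ofVertex w U hU).vertices := rfl

theorem ofVertex_mul_simple (w : W) {U : Finset S} (hU : cs.IsSpherical U) {s : S} (hs : s ∈ U) :
    ofVertex (w * cs.simple s) U hU = ofVertex w U hU :=
  ext_of_mem rfl (mem_vertices_ofVertex _ _) (mul_mem (mem_vertices_ofVertex w hU)
    (Subgroup.subset_closure ⟨s, Finset.mem_coe.mpr hs, rfl⟩))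

theorem vertices_finite (c : cs.Cell) : c.vertices.Finite := by
  have : Finite (cs.special c.type) := c.spherical
  refine ((Set.toFinite (cs.special c.type : Set W)).image (c.base * ·)).subset fun w hw =>
    ⟨c.base⁻¹ * w, inv_mul_mem c.base_mem hw, by simp⟩

theorem incidence_ofVertex_ne_zero [LinearOrder S] (w : W) {U : Finset S} {r : S} (hr : r ∉ U)
    (hU : cs.IsSpherical U) (hrU : cs.IsSpherical (insert r U)) :
    incidence (ofVertex w (insert r U) hrU) (ofVertex w U hU) ≠ 0 := by
  rw [incidence_eq_of_insert (r := r) ((le_iff_of_mem (mem_vertices_ofVertex w hU)).mpr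
    ⟨Finset.subset_insert _ _, mem_vertices_ofVertex w hrU⟩) hr rfl]
  simp

/-- A coface contains the vertex `w`, so its type determines it; counting cofaces reduces to
counting spherical types. -/
theorem exists_eq_ofVertex_of_incidence_ne_zero [LinearOrder S] {w : W} {U : Finset S}
    {hU : cs.IsSpherical U} {c : cs.Cell} (h : incidence c (ofVertex w U hU) ≠ 0) :
    ∃ r, r ∉ U ∧ ∃ hr : cs.IsSpherical (insert r U), c = ofVertex w (insert r U) hr := by
  obtain ⟨hle, hdim⟩ := incidence_ne_zero h
  obtain ⟨r, hr, hc⟩ := exists_type_eq_insert hle hdim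
  have hc' : c.type = insert r U := hc
  exact ⟨r, hr, hc' ▸ c.spherical, ext_of_mem hc (hle.2 (mem_vertices_ofVertex w hU))
    (mem_vertices_ofVertex _ _)⟩

theorem norm_incidence_of_ne_zero [LinearOrder S] {𝕜 : Type*} [RCLike 𝕜] {c d : cs.Cell}
    (h : incidence c d ≠ 0) : ‖(incidence c d : 𝕜)‖ = 1 := by
  have h1 : |incidence c d| = 1 := le_antisymm (abs_incidence_le c d) (Int.one_le_abs h)
  rw [← RCLike.ofReal_intCast, RCLike.norm_ofReal]
  exact_mod_cast h1

theorem mem_ruin_iff {c : cs.Cell} {V T : Finset S} :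
    c ∈ cs.ruin V T ∧ c ∉ cs.ruinBoundary V T ↔ T ⊆ c.type ∧ c.type ⊆ V := by
  constructor
  · rintro ⟨h1, h2⟩
    by_contra h
    exact h2 ⟨h1, h⟩
  · exact fun h => ⟨subset_lowerClosure h, fun hn => hn.2 h⟩

/-- The relative cell of `(Ω(V, T), ∂Ω(V, T))` of type `U` containing the vertex `w`. -/
def ruinCell (w : W) {V T U : Finset S} {k : ℕ} (hTU : T ⊆ U) (hUV : U ⊆ V) (hU : cs.IsSpherical U)
    (hk : U.card = k) : cs.RelCell (cs.ruin V T) (cs.ruinBoundary V T) k :=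
  ⟨ofVertex w U hU, (mem_ruin_iff.mpr ⟨hTU, hUV⟩).1, (mem_ruin_iff.mpr ⟨hTU, hUV⟩).2, hk⟩

end Cell

/-! ### Coefficients of relative ℓ²-cycles -/

open Cell

/-- If `f` is a cycle and the face of type `U` at the vertex `w` lies in at most two cells, of types
`U ∪ {a}` and `U ∪ {b}`, then the coefficients of these have the same absolute value. -/
theorem norm_eq_norm_of_boundary_eq_zero [Fintype S] [LinearOrder S] {𝕜 : Type*} [RCLike 𝕜]
    {V T U : Finset S} {k : ℕ} {f : cs.L2Chain 𝕜 (cs.ruin V T) (cs.ruinBoundary V T) (k + 1)}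
    (hf : boundary 𝕜 (cs.ruin V T) (cs.ruinBoundary V T) (k + 1) k f = 0)
    (hTU : T ⊆ U) {a b : S} (hab : a ≠ b) (ha : a ∉ U) (hb : b ∉ U)
    (haV : insert a U ⊆ V) (hbV : insert b U ⊆ V)
    (hka : (insert a U).card = k + 1) (hkb : (insert b U).card = k + 1)
    (haU : cs.IsSpherical (insert a U)) (hbU : cs.IsSpherical (insert b U))
    (hall : ∀ r, r ∉ U → cs.IsSpherical (insert r U) → r = a ∨ r = b) (w : W) :
    ‖f (ruinCell w (hTU.trans (Finset.subset_insert a U)) haV haU hka)‖ =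
      ‖f (ruinCell w (hTU.trans (Finset.subset_insert b U)) hbV hbU hkb)‖ := by
  classical
  have hU : cs.IsSpherical U := haU.mono (Finset.subset_insert _ _)
  have hk : U.card = k := by rw [Finset.card_insert_of_notMem ha] at hka; omega
  set d := ruinCell w hTU ((Finset.subset_insert a U).trans haV) hU hk with hd
  set ca := ruinCell w (hTU.trans (Finset.subset_insert a U)) haV haU hka with hca
  set cb := ruinCell w (hTU.trans (Finset.subset_insert b U)) hbV hbU hkb with hcb
  have hia : ca.1.incidence d.1 ≠ 0 := incidence_ofVertex_ne_zero w ha hU haU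
  have hib : cb.1.incidence d.1 ≠ 0 := incidence_ofVertex_ne_zero w hb hU hbU
  have hne : ca ≠ cb := fun h => by
    have h1 : insert a U = insert b U := congrArg (fun c => c.1.type) h
    have h2 : a ∈ insert b U := h1 ▸ Finset.mem_insert_self a U
    exact (Finset.mem_insert.mp h2).elim hab ha
  -- The coefficient of `∂f` at `d` thus has only two terms, with signs ±1.
  have hcof : cofaces (cs.ruin V T) (cs.ruinBoundary V T) (k + 1) d.1 = {ca, cb} := by
    ext c
    rw [mem_cofaces, Finset.mem_insert, Finset.mem_singleton]
    refine ⟨fun h => ?_, ?_⟩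
    · obtain ⟨r, hr, hrU, hc⟩ := exists_eq_ofVertex_of_incidence_ne_zero h
      rcases hall r hr hrU with rfl | rfl
      · exact Or.inl (Subtype.ext hc)
      · exact Or.inr (Subtype.ext hc)
    · rintro (rfl | rfl)
      exacts [hia, hib]
  have h0 : boundary 𝕜 (cs.ruin V T) (cs.ruinBoundary V T) (k + 1) k f d = 0 := by rw [hf]; rfl
  rw [boundary_apply, hcof, Finset.sum_pair hne] at h0
  have h1 := congrArg norm (eq_neg_of_add_eq_zero_left h0)
  rwa [norm_neg, norm_mul, norm_mul, norm_incidence_of_ne_zero hia, norm_incidence_of_ne_zero hib,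
    one_mul, one_mul] at h1

/-- A cycle vanishes on a cell with a free face. -/
theorem apply_eq_zero_of_boundary_eq_zero [Fintype S] [LinearOrder S] {𝕜 : Type*} [RCLike 𝕜]
    {V T U : Finset S} {k : ℕ} {f : cs.L2Chain 𝕜 (cs.ruin V T) (cs.ruinBoundary V T) (k + 1)}
    (hf : boundary 𝕜 (cs.ruin V T) (cs.ruinBoundary V T) (k + 1) k f = 0)
    (hTU : T ⊆ U) {a : S} (ha : a ∉ U) (haV : insert a U ⊆ V)
    (hka : (insert a U).card = k + 1) (haU : cs.IsSpherical (insert a U))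
    (hall : ∀ r, r ∉ U → insert r U ⊆ V → cs.IsSpherical (insert r U) → r = a) (w : W) :
    f (ruinCell w (hTU.trans (Finset.subset_insert a U)) haV haU hka) = 0 := by
  have hU : cs.IsSpherical U := haU.mono (Finset.subset_insert _ _)
  have hk : U.card = k := by rw [Finset.card_insert_of_notMem ha] at hka; omega
  set d := ruinCell w hTU ((Finset.subset_insert a U).trans haV) hU hk with hd
  set ca := ruinCell w (hTU.trans (Finset.subset_insert a U)) haV haU hka with hca
  have hia : ca.1.incidence d.1 ≠ 0 := incidence_ofVertex_ne_zero w ha hU haU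
  have hcof : cofaces (cs.ruin V T) (cs.ruinBoundary V T) (k + 1) d.1 = {ca} := by
    ext c
    rw [mem_cofaces, Finset.mem_singleton]
    refine ⟨fun h => ?_, ?_⟩
    · obtain ⟨r, hr, hrU, hc⟩ := exists_eq_ofVertex_of_incidence_ne_zero h
      have hrV : c.1.type ⊆ V := (mem_ruin_iff.mp ⟨c.2.1, c.2.2.1⟩).2
      rw [hc] at hrV
      obtain rfl := hall r hr hrV hrU
      exact Subtype.ext hc
    · rintro rfl
      exact hia
  have h0 : boundary 𝕜 (cs.ruin V T) (cs.ruinBoundary V T) (k + 1) k f d = 0 := by rw [hf]; rfl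
  rw [boundary_apply, hcof, Finset.sum_singleton] at h0
  have h1 := congrArg norm h0
  rw [norm_mul, norm_incidence_of_ne_zero hia, one_mul, norm_zero] at h1
  exact norm_eq_zero.mp h1

/-- Square-summable coefficients tend to 0 along the cofinite filter. This is where the ℓ² condition
enters. -/
theorem L2Chain.finite_norm_eq {𝕜 : Type*} [RCLike 𝕜] {X A : LowerSet cs.Cell} {k : ℕ}
    (f : cs.L2Chain 𝕜 X A k) {N : ℝ} (hN : 0 < N) :
    {c : cs.RelCell X A k | ‖f c‖ = N}.Finite := by
  have h1 := (lp.memℓp f).summable (by norm_num)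
  have h2 := h1.tendsto_cofinite_zero.eventually (gt_mem_nhds (show (0 : ℝ) < N ^ 2 by positivity))
  refine (Filter.eventually_cofinite.mp h2).subset fun c (hc : ‖f c‖ = N) => ?_
  simp [hc]

/-- A square-summable cycle vanishes on a cell `c` of type `U ∪ {a}` if a second cell of type
`U ∪ {b}` shares with it the face of type `U`, no other cell does so, and `{a, b}` generates an
infinite group: the coefficients of the cells of type `U ∪ {a}` at the vertices of a coset of this
group all have the same absolute value. -/
theorem apply_eq_zero_of_not_isSpherical_pair [Fintype S] [LinearOrder S] {𝕜 : Type*} [RCLike 𝕜]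
    {V T U : Finset S} {k : ℕ} {f : cs.L2Chain 𝕜 (cs.ruin V T) (cs.ruinBoundary V T) (k + 1)}
    (hf : boundary 𝕜 (cs.ruin V T) (cs.ruinBoundary V T) (k + 1) k f = 0)
    (hTU : T ⊆ U) {a b : S} (hab : a ≠ b) (ha : a ∉ U) (hb : b ∉ U)
    (haV : insert a U ⊆ V) (hbV : insert b U ⊆ V)
    (hka : (insert a U).card = k + 1) (hkb : (insert b U).card = k + 1)
    (haU : cs.IsSpherical (insert a U)) (hbU : cs.IsSpherical (insert b U))
    (hall : ∀ r, r ∉ U → cs.IsSpherical (insert r U) → r = a ∨ r = b)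
    (hinf : ¬ cs.IsSpherical {a, b}) (w : W) :
    f (ruinCell w (hTU.trans (Finset.subset_insert a U)) haV haU hka) = 0 := by
  by_contra hne
  have heq := norm_eq_norm_of_boundary_eq_zero hf hTU hab ha hb haV hbV hka hkb haU hbU hall
  set ca : W → cs.RelCell (cs.ruin V T) (cs.ruinBoundary V T) (k + 1) := fun v =>
    ruinCell v (hTU.trans (Finset.subset_insert a U)) haV haU hka with hca
  set cb : W → cs.RelCell (cs.ruin V T) (cs.ruinBoundary V T) (k + 1) := fun v =>
    ruinCell v (hTU.trans (Finset.subset_insert b U)) hbV hbU hkb with hcb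
  -- Multiplying by the generator `a` does not change the cell of type `U ∪ {a}`. Multiplying by `b`
  -- does not change the cell of type `U ∪ {b}`, whose coefficient has the same norm.
  have hstep : ∀ v, ∀ s ∈ ({a, b} : Finset S), ‖f (ca (v * cs.simple s))‖ = ‖f (ca v)‖ := by
    intro v s hs
    rcases Finset.mem_insert.mp hs with rfl | hs
    · have : ca (v * cs.simple s) = ca v :=
        Subtype.ext (ofVertex_mul_simple v haU (Finset.mem_insert_self _ _))
      rw [this]
    · obtain rfl := Finset.mem_singleton.mp hs
      have : cb (v * cs.simple s) = cb v :=
        Subtype.ext (ofVertex_mul_simple v hbU (Finset.mem_insert_self _ _))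
      rw [heq (v * cs.simple s), heq v]
      exact congrArg (fun c => ‖f c‖) this
  have horbit : ∀ u ∈ cs.special {a, b}, ‖f (ca (w * u))‖ = ‖f (ca w)‖ := by
    intro u hu
    induction hu using Subgroup.closure_induction_right with
    | one => rw [mul_one]
    | mul_right x hx y hy ih =>
      obtain ⟨s, hs, rfl⟩ := hy
      rw [← mul_assoc, hstep _ s (Finset.mem_coe.mp hs), ih]
    | mul_inv_cancel x hx y hy ih =>
      obtain ⟨s, hs, rfl⟩ := hy
      rw [cs.inv_simple, ← mul_assoc, hstep _ s (Finset.mem_coe.mp hs), ih]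
  have hfin := L2Chain.finite_norm_eq f (norm_pos_iff.mpr hne)
  refine hinf ?_
  -- Finitely many cells carry this norm, each with finitely many vertices, and together they cover
  -- `w W_{a,b}`; so that coset would be finite.
  have hfinV : (⋃ c ∈ {c | ‖f c‖ = ‖f (ca w)‖}, c.1.vertices).Finite :=
    hfin.biUnion fun c _ => c.1.vertices_finite
  have : ((w * ·) '' (cs.special {a, b} : Set W)).Finite := by
    refine hfinV.subset ?_
    rintro _ ⟨u, hu, rfl⟩
    exact Set.mem_biUnion (x := ca (w * u)) (horbit u hu) (mem_vertices_ofVertex _ haU)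
  exact (this.of_finite_image (mul_right_injective w).injOn).to_subtype

end CoxeterSystem

/-! ### Vanishing in degree 4 -/

theorem lemmal {S W : Type*} [Fintype S] [LinearOrder S] [Group W] {M : CoxeterMatrix S}
    (cs : CoxeterSystem M W) (heven : cs.IsEven) (hflag : cs.nerve.IsFlag)
    (hsphere : cs.nerve.IsTriangulationOfSphere 3)
    (𝕜 : Type*) [RCLike 𝕜] (V T : Finset S) (hTV : T ⊆ V) (hT : cs.IsSpherical T)
    (hcard : T.card = 2) :
    Subsingleton
      (CoxeterSystem.ReducedL2Homology 𝕜 (cs.ruin V T) (cs.ruinBoundary V T) 4) := by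
  have hcyc : ∀ f ∈ CoxeterSystem.cycles 𝕜 (cs.ruin V T) (cs.ruinBoundary V T) 4, f = 0 := by
    intro f hf
    have hf' : CoxeterSystem.boundary 𝕜 (cs.ruin V T) (cs.ruinBoundary V T) (3 + 1) 3 f = 0 := hf
    ext c
    obtain ⟨hTc, hcV⟩ := CoxeterSystem.Cell.mem_ruin_iff.mp ⟨c.2.1, c.2.2.1⟩
    have hc4 : c.1.type.card = 4 := c.2.2.2
    obtain ⟨a, b, hab, hsd⟩ := Finset.card_eq_two.mp
      (show (c.1.type \ T).card = 2 by rw [Finset.card_sdiff_of_subset hTc]; omega)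
    have ha : a ∈ c.1.type \ T := by simp [hsd]
    have hb : b ∈ c.1.type \ T := by simp [hsd]
    rw [Finset.mem_sdiff] at ha hb
    -- The face to cross drops `a` and keeps `T`, so it remains a cell of the relative complex.
    set U := insert b T with hU
    have haU : a ∉ U := by simp [hU, hab, ha.2]
    have hU3 : U.card = 3 := by rw [hU, Finset.card_insert_of_notMem hb.2, hcard]
    have hTU : T ⊆ U := Finset.subset_insert _ _
    have htype : c.1.type = insert a U := by
      refine (Finset.eq_of_subset_of_card_le ?_ ?_).symm
      · simp [hU, Finset.insert_subset_iff, ha.1, hb.1, hTc]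
      · rw [Finset.card_insert_of_notMem haU, hU3, hc4]
    have haV : insert a U ⊆ V := htype ▸ hcV
    have hsa : cs.IsSpherical (insert a U) := htype ▸ c.1.spherical
    have hka : (insert a U).card = 3 + 1 := by rw [← htype, hc4]
    have hc : c = CoxeterSystem.Cell.ruinCell c.1.base (hTU.trans (Finset.subset_insert a U))
        haV hsa hka :=
      Subtype.ext (CoxeterSystem.Cell.ext_of_mem htype c.1.base_mem
        (CoxeterSystem.Cell.mem_vertices_ofVertex _ hsa))
    change f c = 0
    rw [hc]
    -- Either a second tetrahedron of type inside `V` contains the triangle `U`, or the face is free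
    -- in the pair.
    by_cases hex : ∃ e, e ∉ U ∧ insert e U ⊆ V ∧ cs.IsSpherical (insert e U) ∧ a ≠ e
    · obtain ⟨e, heU, heV, hse, hae⟩ := hex
      have hsub : ∀ σ : Finset S, cs.IsSpherical σ → U ⊆ σ → σ ⊆ insert a U ∨ σ ⊆ insert e U :=
        fun σ hσ hUσ => hsphere.subset_or_subset hU3 haU heU hae
          ⟨Finset.insert_nonempty _ _, hsa⟩ ⟨Finset.insert_nonempty _ _, hse⟩
          ⟨⟨b, hUσ (Finset.mem_insert_self _ _)⟩, hσ⟩ hUσ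
      refine CoxeterSystem.apply_eq_zero_of_not_isSpherical_pair hf' hTU hae haU heU haV heV hka
        (by rw [Finset.card_insert_of_notMem heU, hU3]) hsa hse ?_ ?_ _
      · intro r hr hsr
        refine (hsub _ hsr (Finset.subset_insert _ _)).imp (fun h => ?_) (fun h => ?_) <;>
          exact (Finset.mem_insert.mp (h (Finset.mem_insert_self r U))).resolve_right hr
      · intro hpair
        -- Apart from `{a, e}`, every pair lies in `U ∪ {a}` or `U ∪ {e}`, so flagness applies. The
        -- resulting simplex lies in neither tetrahedron.
        have hσ : cs.IsSpherical (insert e (insert a U)) := by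
          refine (hflag _ (Finset.insert_nonempty _ _) fun s hs t ht _ =>
            ⟨Finset.insert_nonempty _ _, ?_⟩).2
          simp only [Finset.mem_insert] at hs ht
          have mono : ∀ R : Finset S, cs.IsSpherical R → s ∈ R → t ∈ R →
              cs.IsSpherical {s, t} := fun R hR h1 h2 =>
            hR.mono (Finset.insert_subset h1 (Finset.singleton_subset_iff.mpr h2))
          rcases hs with rfl | rfl | hs <;> rcases ht with rfl | rfl | ht
          · exact mono _ hpair (by simp) (by simp)
          · exact mono _ hpair (by simp) (by simp)
          · exact mono _ hse (by simp) (by simp [ht])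
          · exact mono _ hpair (by simp) (by simp)
          · exact mono _ hpair (by simp) (by simp)
          · exact mono _ hsa (by simp) (by simp [ht])
          · exact mono _ hse (by simp [hs]) (by simp)
          · exact mono _ hsa (by simp [hs]) (by simp)
          · exact mono _ hsa (by simp [hs]) (by simp [ht])
        rcases hsub _ hσ ((Finset.subset_insert _ _).trans (Finset.subset_insert _ _)) with h | h
        · exact (Finset.mem_insert.mp (h (Finset.mem_insert_self e _))).elim hae.symm heU
        · exact (Finset.mem_insert.mp (h (Finset.mem_insert_of_mem
            (Finset.mem_insert_self a U)))).elim hae haU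
    · push Not at hex
      exact CoxeterSystem.apply_eq_zero_of_boundary_eq_zero hf' hTU haU haV hka hsa
        (fun r hr hrV hsr => (hex r hr hrV hsr).symm) _
  have : Subsingleton (CoxeterSystem.cycles 𝕜 (cs.ruin V T) (cs.ruinBoundary V T) 4) :=
    ⟨fun f g => Subtype.ext ((hcyc f f.2).trans (hcyc g g.2).symm)⟩
  exact (Submodule.mkQ_surjective _).subsingleton
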